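/- **Setting.** A branching graph is a graph $\mathbb{G}=\bigsqcup_{n\ge 0}\mathbb{G}_n$ (identified with its vertex set) such that: all levels $\mathbb{G}_n$ are finite and $\mathbb{G}_0=\{\varnothing\}$; every edge is oriented from some $\mathbb{G}_n$ to $\mathbb{G}_{n+1}$ (we write $\mu\nearrow\lambda$ and $|\lambda|=n$ for $\lambda\in\mathbb{G}_n$); every vertex $\mu$ has some $\lambda$ with $\mu\nearrow\lambda$, and every vertex $\lambda\neq\varnothing$ has some $\mu$ with $\mu\nearrow\lambda$; and every edge $\mu\nearrow\lambda$ carries a real multiplicity $\kappa(\mu,\lambda)>0$. Let $\dim(\mu,\lambda)$ be the sum, over all oriented paths from $\mu$ to $\lambda$, of the products of the multiplicities along the path; put $\dim\lambda=\dim(\varnothing,\lambda)$ and write $\mu\subseteq\lambda$ if $\dim(\mu,\lambda)\ne0$. Put $$\mathcal{P}^*_\mu(\lambda)=|\lambda|(|\lambda|-1)\cdots(|\lambda|-|\mu|+1)\,\frac{\dim(\mu,\lambda)}{\dim\lambda}.$$ On finitely supported complex functions on $\mathbb{G}$, with standard basis $\{\underline\lambda\}_{\lambda\in\mathbb{G}}$,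 let $U^\circ\underline\lambda=\sum_{\nu:\lambda\nearrow\nu}\kappa(\lambda,\nu)\,\underline\nu$ and $D^\circ\underline\lambda=\sum_{\mu:\mu\nearrow\lambda}\kappa(\mu,\lambda)\,\underline\mu$. Assume that $\mathbb{G}$ is $r$-self-dual for some real $r>0$, that is, $[D^\circ,U^\circ]=r\mathbf 1$. The Plancherel measures are $$\mathrm{Pl}_n(\lambda)=\frac1{Z_n}\big((U^\circ)^n\underline\varnothing,\underline\lambda\big)\big((D^\circ)^n\underline\lambda,\underline\varnothing\big)=\frac{(\dim\lambda)^2}{r^n\,n!},\qquad\lambda\in\mathbb{G}_n,$$ where $Z_n$ normalizes the total mass to $1$. For $\gamma>0$, the poissonized Plancherel measure is $$\mathrm{Pl}_\gamma(\lambda)=e^{-\gamma r}\frac{(\gamma r)^{|\lambda|}}{|\lambda|!}\,\mathrm{Pl}_{|\lambda|}(\lambda)=e^{-\gamma r}\gamma^{|\lambda|}\Big(\frac{\dim\lambda}{|\lambda|!}\Big)^2,\qquad\lambda\in\mathbb{G}.$$ Let $p^\downarrow(\lambda,\mu)=\kappa(\mu,\lambda)\dim\mu/\dim\lambda$ for $\mu\nearrow\lambda$,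 and $p^\uparrow(\lambda,\nu)=\frac{\mathrm{Pl}_{|\lambda|+1}(\nu)}{\mathrm{Pl}_{|\lambda|}(\lambda)}\,p^\downarrow(\nu,\lambda)$ for $\lambda\nearrow\nu$. Let $A$ be the operator $(Af)(\lambda)=\sum_\rho Q_{\lambda\rho}f(\rho)$ on the finitely supported functions in $\ell^2(\mathbb{G},\mathrm{Pl}_\gamma)$, with the jump rates $Q_{\lambda\mu}=|\lambda|\,p^\downarrow(\lambda,\mu)$ for $\mu\nearrow\lambda$, $Q_{\lambda\nu}=\gamma r\,p^\uparrow(\lambda,\nu)$ for $\lambda\nearrow\nu$, $Q_{\lambda\lambda}=-|\lambda|-\gamma r$, and all other rates zero. **Proposition.** For $\lambda\in\mathbb{G}$ let $$\mathfrak{C}_\lambda=\sum_{\mu\subseteq\lambda}(-\gamma)^{|\lambda|-|\mu|}\,\frac{\dim(\mu,\lambda)}{(|\lambda|-|\mu|)!}\,\mathcal{P}^*_\mu .$$ 1. The functions $\mathfrak{C}_\lambda$ belong to, and form an orthogonal basis of, the complex Hilbert space $\ell^2(\mathbb{G},\mathrm{Pl}_\gamma)$ (they are pairwise orthogonal and their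 linear span is dense), and $$(\mathfrak{C}_\lambda,\mathfrak{C}_\mu)_{\mathrm{Pl}_\gamma}=\delta_{\lambda\mu}\,\gamma^{|\lambda|}\qquad\text{for all }\lambda,\mu\in\mathbb{G}.$$ 2. The operator $A$ is closable in $\ell^2(\mathbb{G},\mathrm{Pl}_\gamma)$; every $\mathfrak{C}_\lambda$ lies in the domain of its closure $\bar A$ (the generator of the jump dynamics), and $\bar A\,\mathfrak{C}_\lambda=-|\lambda|\,\mathfrak{C}_\lambda$. -/

import Mathlib

open MeasureTheory
open scoped Classical ENNReal

universe u

noncomputable section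

/-- A branching graph: a graded graph with finite levels, a single vertex `root` on level `0`,
edges going from each level to the next one, every vertex having an upper neighbour and every
vertex except `root` having a lower neighbour, and a strictly positive (real) multiplicity
`mult m l` attached to every edge `m ↗ l`.  (The values of `mult` off the edges are never used.) -/
structure BranchingGraph where
  Vertex : Type u
  level : Vertex → ℕ
  Edge : Vertex → Vertex → Prop
  root : Vertex
  mult : Vertex → Vertex → ℝ
  finite_level : ∀ n : ℕ, {l : Vertex | level l = n}.Finite
  level_eq_zero_iff : ∀ l : Vertex, level l = 0 ↔ l = root
  level_of_edge : ∀ {m l : Vertex}, Edge m l → level l = level m + 1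
  exists_upper : ∀ m : Vertex, ∃ l : Vertex, Edge m l
  exists_lower : ∀ l : Vertex, l ≠ root → ∃ m : Vertex, Edge m l
  mult_pos : ∀ {m l : Vertex}, Edge m l → 0 < mult m l

namespace BranchingGraph

variable (G : BranchingGraph.{u})

/-- The edges, as arrows of a quiver; `Quiver.Path m l` is then the type of oriented paths
from `m` to `l`. -/
instance : Quiver.{0} G.Vertex where
  Hom m l := PLift (G.Edge m l)

instance : MeasurableSpace G.Vertex := ⊤

instance : DiscreteMeasurableSpace G.Vertex := ⟨fun _ => trivial⟩

/-- The `n`-th level of the graph. -/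
def floor (n : ℕ) : Finset G.Vertex := (G.finite_level n).toFinset

theorem mem_floor {n : ℕ} {l : G.Vertex} : l ∈ G.floor n ↔ G.level l = n := by
  simp [floor]

/-- The vertices `n` with `l ↗ n`. -/
def upper (l : G.Vertex) : Finset G.Vertex := {n ∈ G.floor (G.level l + 1) | G.Edge l n}

/-- The vertices `m` with `m ↗ l`. -/
def lower (l : G.Vertex) : Finset G.Vertex := {m ∈ G.floor (G.level l - 1) | G.Edge m l}

theorem mem_upper {l n : G.Vertex} : n ∈ G.upper l ↔ G.Edge l n := by
  simp only [upper, Finset.mem_filter, mem_floor, and_iff_right_iff_imp]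
  exact fun h => G.level_of_edge h

theorem mem_lower {l m : G.Vertex} : m ∈ G.lower l ↔ G.Edge m l := by
  simp only [lower, Finset.mem_filter, mem_floor, and_iff_right_iff_imp]
  intro h
  have := G.level_of_edge h
  omega

/-- There are finitely many oriented paths between two vertices, so that the sum in `relDim`
below is a genuine finite sum. -/
theorem finite_path (m l : G.Vertex) : Finite (Quiver.Path m l) := by
  suffices H : ∀ (n : ℕ) (l : G.Vertex), G.level l = n → Finite (Quiver.Path m l) from
    H _ l rfl
  intro n
  induction n with
  | zero =>
    intro l hl
    refine @Finite.of_injective _ Unit _ (fun _ => ()) ?_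
    intro p q _
    cases p with
    | nil =>
      cases q with
      | nil => rfl
      | cons _ e => have := G.level_of_edge e.down; omega
    | cons _ e => have := G.level_of_edge e.down; omega
  | succ n ih =>
    intro l hl
    have hfin : Finite {k : G.Vertex // G.level k = n} := (G.finite_level n).to_subtype
    have : ∀ k : {k : G.Vertex // G.level k = n}, Finite (Quiver.Path m k.1) :=
      fun k => ih k.1 k.2
    have hlev : ∀ {b : G.Vertex}, (b ⟶ l) → G.level b = n := by
      intro b e
      have := G.level_of_edge e.down
      omega
    let f : Quiver.Path m l → Option (Σ k : {k : G.Vertex // G.level k = n}, Quiver.Path m k.1) :=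
      fun p => match p with
        | Quiver.Path.nil => none
        | Quiver.Path.cons (b := b) p e => some ⟨⟨b, hlev e⟩, p⟩
    refine Finite.of_injective f ?_
    intro p q h
    cases p with
    | nil =>
      cases q with
      | nil => rfl
      | cons q e' => simp [f] at h
    | cons p e =>
      cases q with
      | nil => simp [f] at h
      | cons q e' =>
        simp only [f, Option.some.injEq, Sigma.mk.injEq, Subtype.mk.injEq] at h
        obtain ⟨h1, h2⟩ := h
        subst h1
        obtain rfl := eq_of_heq h2
        have he : e = e' := PLift.down_injective (Subsingleton.elim e.down e'.down)
        rw [he]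

/-- The relative dimension `dim(m, l)`: the sum over all oriented paths from `m` to `l` of the
product of the multiplicities of the edges of the path. -/
def relDim (m l : G.Vertex) : ℝ :=
  ∑ᶠ p : Quiver.Path m l, p.weightOfEPs G.mult

/-- The dimension `dim l = dim(∅, l)`. -/
def dim (l : G.Vertex) : ℝ := G.relDim G.root l

/-- The (finite) set of vertices `m ⊆ l`, that is, of those `m` with `dim(m, l) ≠ 0`. -/
def below (l : G.Vertex) : Finset G.Vertex :=
  {m ∈ (Finset.range (G.level l + 1)).biUnion G.floor | G.relDim m l ≠ 0}

/-- The relative dimension function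
`P*_m (l) = |l| (|l| - 1) ⋯ (|l| - |m| + 1) * dim(m, l) / dim l`. -/
def relDimFun (m l : G.Vertex) : ℝ :=
  ((G.level l).descFactorial (G.level m) : ℝ) * (G.relDim m l / G.dim l)

section Operators

variable (𝕜 : Type*) [RCLike 𝕜]

/-- The operator `U°` on finitely supported functions,
`U° 1_l = ∑_{n ↘ l} κ(l, n) 1_n`. -/
def upOp : Module.End 𝕜 (G.Vertex →₀ 𝕜) :=
  Finsupp.linearCombination 𝕜 fun l : G.Vertex =>
    ∑ n ∈ G.upper l, Finsupp.single n ((G.mult l n : ℝ) : 𝕜)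

/-- The operator `D°` on finitely supported functions,
`D° 1_l = ∑_{m ↗ l} κ(m, l) 1_m`. -/
def downOp : Module.End 𝕜 (G.Vertex →₀ 𝕜) :=
  Finsupp.linearCombination 𝕜 fun l : G.Vertex =>
    ∑ m ∈ G.lower l, Finsupp.single m ((G.mult m l : ℝ) : 𝕜)

end Operators

/-- The graph is `r`-self-dual: `[D°, U°] = r · 1` on finitely supported complex functions. -/
def IsSelfDual (r : ℝ) : Prop :=
  G.downOp ℂ * G.upOp ℂ - G.upOp ℂ * G.downOp ℂ = (r : ℂ) • (1 : Module.End ℂ (G.Vertex →₀ ℂ))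

/-- `((U°)ⁿ 1_∅, 1_l) ((D°)ⁿ 1_l, 1_∅)`. -/
def plancherelWeight (n : ℕ) (l : G.Vertex) : ℝ :=
  ((G.upOp ℝ ^ n) (Finsupp.single G.root 1)) l * ((G.downOp ℝ ^ n) (Finsupp.single l 1)) G.root

/-- The Plancherel measure `Pl_n` on the `n`-th level (its value at the vertex `l` of level `n`):
the normalized weights. -/
def plancherel (n : ℕ) (l : G.Vertex) : ℝ :=
  G.plancherelWeight n l / ∑ k ∈ G.floor n, G.plancherelWeight n k

/-- The poissonized Plancherel measure of a vertex: the mixture of the measures `Pl_n` by means of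
the Poisson distribution with parameter `γ r`. -/
def poissonPlancherel (r γ : ℝ) (l : G.Vertex) : ℝ :=
  Real.exp (-(γ * r)) * (γ * r) ^ G.level l / (G.level l).factorial * G.plancherel (G.level l) l

/-- The poissonized Plancherel measure `Pl_γ` as a measure on the set of vertices. -/
def poissonPlancherelMeasure (r γ : ℝ) : Measure G.Vertex :=
  Measure.sum fun l : G.Vertex => ENNReal.ofReal (G.poissonPlancherel r γ l) • Measure.dirac l

/-- The down transition probabilities `p↓(l, m)`. -/
def pDown (l m : G.Vertex) : ℝ :=
  if G.Edge m l then G.mult m l * G.dim m / G.dim l else 0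

/-- The up transition probabilities `p↑(l, n)` of the coherent system of Plancherel measures. -/
def pUp (l n : G.Vertex) : ℝ :=
  G.plancherel (G.level l + 1) n / G.plancherel (G.level l) l * G.pDown n l

/-- The jump rates of the dynamics on the graph: the level performs a birth and death process with
rates `n` (down) and `γ r` (up), and the new vertex is chosen by `p↓`, respectively `p↑`. -/
def jumpRate (r γ : ℝ) (l k : G.Vertex) : ℝ :=
  if k = l then -((G.level l : ℝ) + γ * r)
  else if G.Edge k l then (G.level l : ℝ) * G.pDown l k
  else if G.Edge l k then γ * r * G.pUp l k
  else 0

/-- `(A f)(l) = ∑_k Q_{l k} f(k)` for a finitely supported function `f`. -/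
def jumpOp (r γ : ℝ) (f : G.Vertex →₀ ℂ) (l : G.Vertex) : ℂ :=
  f.sum fun k c => (G.jumpRate r γ l k : ℂ) * c

/-- The Hilbert space `ℓ²(G, Pl_γ)` of complex functions. -/
abbrev ell2 (r γ : ℝ) : Type u := Lp ℂ 2 (G.poissonPlancherelMeasure r γ)

/-- The graph of the operator `A` of `ℓ²(G, Pl_γ)` with domain the finitely supported functions:
the set of all pairs `(f, A f)`. -/
def preGeneratorGraph (r γ : ℝ) : Submodule ℂ (G.ell2 r γ × G.ell2 r γ) where
  carrier := {x | ∃ f : G.Vertex →₀ ℂ,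
    x.1 =ᵐ[G.poissonPlancherelMeasure r γ] f ∧
      x.2 =ᵐ[G.poissonPlancherelMeasure r γ] G.jumpOp r γ f}
  add_mem' := by
    rintro x y ⟨f, hf1, hf2⟩ ⟨g, hg1, hg2⟩
    refine ⟨f + g, ?_, ?_⟩
    · filter_upwards [Lp.coeFn_add x.1 y.1, hf1, hg1] with l h1 h2 h3
      simp only [Prod.fst_add, h1, Pi.add_apply, h2, h3, Finsupp.add_apply]
    · filter_upwards [Lp.coeFn_add x.2 y.2, hf2, hg2] with l h1 h2 h3
      simp only [Prod.snd_add, h1, Pi.add_apply, h2, h3, jumpOp]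
      rw [Finsupp.sum_add_index' (by simp) (by intros; ring)]
  zero_mem' := by
    refine ⟨0, ?_, ?_⟩
    · filter_upwards [Lp.coeFn_zero ℂ 2 (G.poissonPlancherelMeasure r γ)] with l h
      simpa using h
    · filter_upwards [Lp.coeFn_zero ℂ 2 (G.poissonPlancherelMeasure r γ)] with l h
      simpa [jumpOp] using h
  smul_mem' := by
    rintro c x ⟨f, hf1, hf2⟩
    refine ⟨c • f, ?_, ?_⟩
    · filter_upwards [Lp.coeFn_smul c x.1, hf1] with l h1 h2
      simp [h1, h2]
    · filter_upwards [Lp.coeFn_smul c x.2, hf2] with l h1 h2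
      simp only [Prod.smul_snd, h1, Pi.smul_apply, h2, jumpOp, smul_eq_mul]
      rw [Finsupp.sum_smul_index (by simp), Finsupp.mul_sum]
      exact Finsupp.sum_congr fun _ _ => by ring

/-- The operator `A` of `ℓ²(G, Pl_γ)`, with domain the finitely supported functions.  The generator
of the jump dynamics is its closure. -/
def preGenerator (r γ : ℝ) : G.ell2 r γ →ₗ.[ℂ] G.ell2 r γ :=
  (G.preGeneratorGraph r γ).toLinearPMap

/-- The functions
`C_l = ∑_{m ⊆ l} (-γ)^(|l| - |m|) * dim(m, l) / (|l| - |m|)! * P*_m`. -/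
def charlierFun (γ : ℝ) (l : G.Vertex) (x : G.Vertex) : ℝ :=
  ∑ m ∈ G.below l, (-γ) ^ (G.level l - G.level m) *
    (G.relDim m l / (G.level l - G.level m).factorial) * G.relDimFun m x

end BranchingGraph

end

/-! ### Relative dimensions: splitting off the last or the first edge of a path -/

noncomputable section

namespace BranchingGraph

variable (G : BranchingGraph.{u})

/-! Everything rests on the matrix E(m, x) = dim(m, x) / (|x| - |m|)! of exp U° (`expKernel`). Since
U° and D° use the same multiplicities, they are transposes of each other, and self-duality gives D°
exp(U°) = exp(U°) (D° + r) (`IsSelfDual.upperSum_expKernel`). Exponentiating D° as well yields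
exp(D°) exp(U°) = e^r exp(U°) exp(D°); its level-by-level form is `IsSelfDual.sum_floor_expKernel`.
Weighting level |x| by t^|x| and summing gives `IsSelfDual.hasSum_expKernel`: ∑_x t^|x| E(m, x) E(k,
x) = e^(tr) ∑_y t^(|m| + |k| - |y|) E(y, m) E(y, k).

Up to the factor (-γ)^|l| |x|! / dim x, the function C_l(x) is the symmetric kernel K(l, x) = ∑_m
(-1/γ)^|m| E(m, l) E(m, x), and multiplication by (|x|! / dim x)² turns Pl_γ into the weight e^(-γr)
γ^|x|. In ∑_x γ^|x| K(l, x) K(k, x) the formula above, at t = γ, combines γ^|m| with (-1/γ)^|m| into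
signs, so that exp(-U°) exp(U°) = 1 can be applied twice; only the diagonal survives
(`IsSelfDual.hasSum_charlierKernel`). By the symmetry of K the same identity is an orthogonality
relation with summation over the index l. On the diagonal it is Parseval's identity for the
indicator of a vertex, so all indicators lie in the closed span of the C_l, which is completeness.

Conjugation by |x|! / dim x turns the jump rates into U° + γ D° - |x| - γ r. The commutation
relation then shows that A acts on P*_m pointwise as -|m| P*_m + γ ∑_{k ↗ m} κ(k, m) P*_k, and a
summation by parts against the coefficients of C_l produces the eigenvalue -|l| (`sum_eigenvalue`).
The analytic part is soft: rows of the rate matrix are finite and evaluations are continuous, whence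
closability; truncations of P*_m converge in graph norm by domination, whence membership in the
domain of the closure. -/

theorem level_eq_add_length {m l : G.Vertex} (p : Quiver.Path m l) :
    G.level l = G.level m + p.length := by
  induction p with
  | nil => rfl
  | cons p e ih => rw [G.level_of_edge e.down, ih, Quiver.Path.length_cons, add_assoc]

theorem relDim_eq_zero {m l : G.Vertex} (h : G.level l ≤ G.level m) (hne : m ≠ l) :
    G.relDim m l = 0 := by
  have : IsEmpty (Quiver.Path m l) := by
    refine ⟨fun p => hne ?_⟩
    have := G.level_eq_add_length p
    exact Quiver.Path.eq_of_length_zero p (by omega)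
  rw [relDim, finsum_of_isEmpty]

theorem relDim_self (m : G.Vertex) : G.relDim m m = 1 := by
  have : Unique (Quiver.Path m m) :=
    { default := Quiver.Path.nil
      uniq := fun p => by
        have := G.level_eq_add_length p
        exact Quiver.Path.eq_nil_of_length_zero p (by omega) }
  rw [relDim, finsum_unique, Subsingleton.elim this.default (Quiver.Path.nil : Quiver.Path m m),
    Quiver.Path.weightOfEPs_nil]

/-- The non-trivial paths ending at a vertex, sorted by their next-to-last vertex. -/
def pathEquivLower {m l : G.Vertex} (h : m ≠ l) :
    Quiver.Path m l ≃ Σ k : G.lower l, Quiver.Path m k.1 where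
  toFun p := match p, h with
    | Quiver.Path.nil, h => absurd rfl h
    | Quiver.Path.cons (b := b) p e, _ => ⟨⟨b, G.mem_lower.2 e.down⟩, p⟩
  invFun q := q.2.cons ⟨G.mem_lower.1 q.1.2⟩
  left_inv p := by
    cases p with
    | nil => exact absurd rfl h
    | cons p e => rfl
  right_inv q := rfl

theorem relDim_eq_sum_lower {m l : G.Vertex} (h : m ≠ l) :
    G.relDim m l = ∑ k ∈ G.lower l, G.mult k l * G.relDim m k := by
  have hf : ∀ k l : G.Vertex, Finite (Quiver.Path k l) := G.finite_path
  have hF : ∀ k l : G.Vertex, Fintype (Quiver.Path k l) := fun k l => Fintype.ofFinite _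
  rw [relDim, finsum_eq_sum_of_fintype, ← (G.pathEquivLower h).symm.sum_comp,
    Fintype.sum_sigma, ← Finset.sum_coe_sort (G.lower l)]
  refine Finset.sum_congr rfl fun k _ => ?_
  rw [relDim, finsum_eq_sum_of_fintype, Finset.mul_sum]
  refine Finset.sum_congr rfl fun p _ => ?_
  rw [mul_comm]
  exact Quiver.Path.weightOfEPs_cons G.mult p _

theorem level_lower {m l : G.Vertex} (h : m ∈ G.lower l) : G.level l = G.level m + 1 :=
  G.level_of_edge (G.mem_lower.1 h)

theorem level_upper {m l : G.Vertex} (h : l ∈ G.upper m) : G.level l = G.level m + 1 :=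
  G.level_of_edge (G.mem_upper.1 h)

theorem mem_lower_iff_mem_upper {m l : G.Vertex} : m ∈ G.lower l ↔ l ∈ G.upper m := by
  rw [mem_lower, mem_upper]

/-! ### The two operators on functions, and their transposition -/

/-- `U°` acting on arbitrary functions. -/
def lowerSum (f : G.Vertex → ℝ) (x : G.Vertex) : ℝ := ∑ y ∈ G.lower x, G.mult y x * f y

/-- `D°` acting on arbitrary functions. -/
def upperSum (f : G.Vertex → ℝ) (y : G.Vertex) : ℝ := ∑ x ∈ G.upper y, G.mult y x * f x

/-- The vertices of level at most `N`. -/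
def ball (N : ℕ) : Finset G.Vertex := (Finset.range (N + 1)).biUnion G.floor

theorem mem_ball {N : ℕ} {l : G.Vertex} : l ∈ G.ball N ↔ G.level l ≤ N := by
  simp [ball, mem_floor]

theorem sum_floor_mul_lowerSum (n : ℕ) (f g : G.Vertex → ℝ) :
    ∑ x ∈ G.floor (n + 1), f x * G.lowerSum g x = ∑ y ∈ G.floor n, G.upperSum f y * g y := by
  simp only [lowerSum, upperSum, Finset.mul_sum, Finset.sum_mul]
  rw [Finset.sum_comm' (s' := G.upper) (t' := G.floor n)]
  · exact Finset.sum_congr rfl fun _ _ => Finset.sum_congr rfl fun _ _ => by ring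
  · intro x y
    rw [mem_lower_iff_mem_upper, mem_floor, mem_floor, and_comm]
    refine ⟨fun h => ⟨h.1, ?_⟩, fun h => ⟨h.1, ?_⟩⟩ <;> have := G.level_upper h.1 <;> omega

/-- Summation by parts. The edges leaving the ball contribute nothing because `f` vanishes above
level `N`, so there is no boundary term. -/
theorem sum_ball_mul_lowerSum (N : ℕ) (f g : G.Vertex → ℝ)
    (hf : ∀ x, N < G.level x → f x = 0) :
    ∑ x ∈ G.ball N, f x * G.lowerSum g x = ∑ y ∈ G.ball N, G.upperSum f y * g y := by
  have hsub : ∑ x ∈ G.ball N, f x * G.lowerSum g x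
      = ∑ x ∈ G.ball (N + 1), f x * G.lowerSum g x := by
    refine Finset.sum_subset (fun x hx => ?_) fun x _ hx => ?_
    · rw [mem_ball] at hx ⊢; omega
    · rw [mem_ball, not_le] at hx
      rw [hf x hx, zero_mul]
  rw [hsub]
  simp only [lowerSum, upperSum, Finset.mul_sum, Finset.sum_mul]
  rw [Finset.sum_comm' (s' := G.upper) (t' := G.ball N)]
  · exact Finset.sum_congr rfl fun _ _ => Finset.sum_congr rfl fun _ _ => by ring
  · intro x y
    rw [mem_lower_iff_mem_upper, mem_ball, mem_ball, and_comm]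
    refine ⟨fun h => ⟨h.1, ?_⟩, fun h => ⟨h.1, ?_⟩⟩ <;> have := G.level_upper h.1 <;> omega

theorem lowerSum_relDim_of_level_le {m l : G.Vertex} (h : G.level l ≤ G.level m) :
    ∑ k ∈ G.lower l, G.mult k l * G.relDim m k = 0 := by
  refine Finset.sum_eq_zero fun k hk => ?_
  have := G.level_lower hk
  rw [G.relDim_eq_zero (by omega) (by rintro rfl; omega), mul_zero]

theorem relDim_eq_ite_add_lowerSum (m l : G.Vertex) :
    G.relDim m l = (if m = l then 1 else 0) + G.lowerSum (G.relDim m) l := by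
  by_cases h : m = l
  · subst h
    rw [if_pos rfl, lowerSum, G.lowerSum_relDim_of_level_le le_rfl, relDim_self, add_zero]
  · rw [if_neg h, zero_add, lowerSum, G.relDim_eq_sum_lower h]

/-- The recursion by the first edge of a path. It follows from the recursion by the last edge: with
the claim known one level below, the first and the last edge are split off in either order. -/
theorem relDim_eq_ite_add_upperSum (m l : G.Vertex) :
    G.relDim m l = (if m = l then 1 else 0) + G.upperSum (fun k => G.relDim k l) m := by
  induction hn : G.level l generalizing l with
  | zero =>
    have h0 : G.upperSum (fun k => G.relDim k l) m = 0 := by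
      refine Finset.sum_eq_zero fun k hk => ?_
      have := G.level_upper hk
      dsimp only
      rw [G.relDim_eq_zero (by omega) (by rintro rfl; omega), mul_zero]
    rw [h0, add_zero]
    split_ifs with h
    · subst h; exact G.relDim_self m
    · exact G.relDim_eq_zero (by omega) h
  | succ n ih =>
    have h1 : G.lowerSum (G.relDim m) l
        = ∑ y ∈ G.lower l, G.mult y l * (if m = y then 1 else 0)
          + ∑ x ∈ G.upper m, G.mult m x * G.lowerSum (G.relDim x) l := by
      have : G.lowerSum (G.relDim m) l = ∑ y ∈ G.lower l, G.mult y l *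
          ((if m = y then 1 else 0) + G.upperSum (fun k => G.relDim k y) m) := by
        refine Finset.sum_congr rfl fun y hy => ?_
        rw [← ih y]
        have := G.level_lower hy
        omega
      rw [this]
      simp only [mul_add, Finset.sum_add_distrib, upperSum, lowerSum, Finset.mul_sum]
      congr 1
      rw [Finset.sum_comm]
      exact Finset.sum_congr rfl fun _ _ => Finset.sum_congr rfl fun _ _ => by ring
    have h2 : G.upperSum (fun k => G.relDim k l) m
        = ∑ x ∈ G.upper m, G.mult m x * (if x = l then 1 else 0)
          + ∑ x ∈ G.upper m, G.mult m x * G.lowerSum (G.relDim x) l := by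
      rw [← Finset.sum_add_distrib, upperSum]
      refine Finset.sum_congr rfl fun x _ => ?_
      rw [G.relDim_eq_ite_add_lowerSum x l, mul_add]
    rw [relDim_eq_ite_add_lowerSum, h1, h2]
    congr 2
    simp only [mul_ite, mul_one, mul_zero, Finset.sum_ite_eq, Finset.sum_ite_eq',
      mem_lower_iff_mem_upper]

theorem relDim_nonneg (m l : G.Vertex) : 0 ≤ G.relDim m l := by
  induction hn : G.level l generalizing l with
  | zero =>
    by_cases h : m = l
    · subst h; rw [relDim_self]; exact zero_le_one
    · exact (G.relDim_eq_zero (by omega) h).ge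
  | succ n ih =>
    rw [relDim_eq_ite_add_lowerSum]
    refine add_nonneg (by split_ifs <;> norm_num) (Finset.sum_nonneg fun y hy => ?_)
    have := G.level_lower hy
    exact mul_nonneg (G.mult_pos (G.mem_lower.1 hy)).le (ih y (by omega))

theorem level_root : G.level G.root = 0 := (G.level_eq_zero_iff _).2 rfl

theorem dim_pos (l : G.Vertex) : 0 < G.dim l := by
  induction hn : G.level l generalizing l with
  | zero =>
    obtain rfl := (G.level_eq_zero_iff l).1 hn
    rw [dim, relDim_self]; exact zero_lt_one
  | succ n ih =>
    have hne : G.root ≠ l := by rintro rfl; rw [level_root] at hn; omega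
    obtain ⟨m, hm⟩ := G.exists_lower l hne.symm
    rw [dim, relDim_eq_sum_lower _ hne]
    refine Finset.sum_pos (fun y hy => ?_) ⟨m, G.mem_lower.2 hm⟩
    have := G.level_lower hy
    exact mul_pos (G.mult_pos (G.mem_lower.1 hy)) (ih y (by omega))

/-! ### The exponential of U° -/

/-- The matrix entries `dim(m, x) / (|x| - |m|)!` of the exponential of `U°`. -/
def expKernel (m x : G.Vertex) : ℝ := G.relDim m x / (G.level x - G.level m).factorial

theorem expKernel_nonneg (m x : G.Vertex) : 0 ≤ G.expKernel m x :=
  div_nonneg (G.relDim_nonneg m x) (Nat.cast_nonneg _)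

theorem expKernel_self (m : G.Vertex) : G.expKernel m m = 1 := by
  simp [expKernel, relDim_self]

theorem expKernel_eq_zero {m l : G.Vertex} (h : G.level l ≤ G.level m) (hne : m ≠ l) :
    G.expKernel m l = 0 := by
  rw [expKernel, G.relDim_eq_zero h hne, zero_div]

theorem expKernel_eq_zero_of_lt {m l : G.Vertex} (h : G.level l < G.level m) :
    G.expKernel m l = 0 :=
  G.expKernel_eq_zero h.le (by rintro rfl; omega)

theorem expKernel_root (x : G.Vertex) :
    G.expKernel G.root x = G.dim x / (G.level x).factorial := by
  rw [expKernel, level_root, Nat.sub_zero, dim]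

theorem mul_inv_factorial_sub {a b : ℕ} (h : a < b) :
    ((b : ℝ) - a) * ((b - a).factorial : ℝ)⁻¹ = ((b - a - 1).factorial : ℝ)⁻¹ := by
  obtain ⟨c, rfl⟩ : ∃ c, b = a + c + 1 := ⟨b - a - 1, by omega⟩
  have h1 : a + c + 1 - a = c + 1 := by omega
  rw [h1, Nat.add_sub_cancel, Nat.factorial_succ]
  have := Nat.factorial_ne_zero c
  push_cast
  field_simp
  ring

/-- The relation U° exp(U°) = [level, exp(U°)]: U° raises the level by one, so commuting with the
level acts on its exponential as a derivation. -/
theorem lowerSum_expKernel (m x : G.Vertex) :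
    G.lowerSum (G.expKernel m) x = ((G.level x : ℝ) - G.level m) * G.expKernel m x := by
  rcases lt_or_ge (G.level m) (G.level x) with h | h
  · have hne : m ≠ x := by rintro rfl; omega
    rw [expKernel, G.relDim_eq_sum_lower hne, div_eq_mul_inv, mul_left_comm,
      mul_inv_factorial_sub h, Finset.sum_mul, lowerSum]
    refine Finset.sum_congr rfl fun y hy => ?_
    have := G.level_lower hy
    rw [expKernel, show G.level y - G.level m = G.level x - G.level m - 1 by omega]
    ring
  · have h1 : G.lowerSum (G.expKernel m) x = 0 := by
      refine Finset.sum_eq_zero fun y hy => ?_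
      have := G.level_lower hy
      rw [G.expKernel_eq_zero_of_lt (by omega), mul_zero]
    by_cases hne : m = x
    · subst hne; simp [h1]
    · rw [h1, G.expKernel_eq_zero h hne, mul_zero]

theorem upperSum_expKernel_left (m x : G.Vertex) :
    G.upperSum (fun k => G.expKernel k x) m
      = ((G.level x : ℝ) - G.level m) * G.expKernel m x := by
  rcases lt_or_ge (G.level m) (G.level x) with h | h
  · have hne : m ≠ x := by rintro rfl; omega
    rw [expKernel, G.relDim_eq_ite_add_upperSum m x, if_neg hne, zero_add, div_eq_mul_inv,
      mul_left_comm, mul_inv_factorial_sub h, upperSum, upperSum, Finset.sum_mul]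
    refine Finset.sum_congr rfl fun y hy => ?_
    have := G.level_upper hy
    rw [expKernel, show G.level x - G.level y = G.level x - G.level m - 1 by omega]
    ring
  · have h1 : G.upperSum (fun k => G.expKernel k x) m = 0 := by
      refine Finset.sum_eq_zero fun y hy => ?_
      have := G.level_upper hy
      dsimp only
      rw [G.expKernel_eq_zero_of_lt (by omega), mul_zero]
    by_cases hne : m = x
    · subst hne; simp [h1]
    · rw [h1, G.expKernel_eq_zero h hne, mul_zero]

/-- The matrix of `exp U°` is inverse to that of `exp (-U°)`. -/
theorem sum_neg_one_pow_mul_expKernel (N : ℕ) (k l : G.Vertex) (hl : G.level l ≤ N) :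
    ∑ m ∈ G.ball N, (-1) ^ (G.level l + G.level m) * G.expKernel m l * G.expKernel k m
      = if k = l then 1 else 0 := by
  by_cases hkl : G.level k = G.level l
  · rw [Finset.sum_eq_single_of_mem l (G.mem_ball.2 hl)]
    · rw [expKernel_self, ← two_mul, pow_mul]
      split_ifs with h
      · subst h; simp [expKernel_self]
      · simp [G.expKernel_eq_zero hkl.ge h]
    · intro m _ hm
      rcases le_or_gt (G.level l) (G.level m) with h | h
      · rw [G.expKernel_eq_zero h hm]; ring
      · rw [G.expKernel_eq_zero_of_lt (show G.level m < G.level k by omega)]; ring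
  · rw [if_neg (by rintro rfl; exact hkl rfl)]
    have hne : (G.level l : ℝ) - G.level k ≠ 0 := by
      rw [sub_ne_zero]; exact_mod_cast Ne.symm hkl
    -- The sum times |l| - |k| splits as (|l| - |m|) + (|m| - |k|); each part comes from an operator
    -- acting on one of the two kernels, and summation by parts cancels them.
    refine (mul_eq_zero.1 ?_).resolve_left hne
    have key := G.sum_ball_mul_lowerSum N
      (fun m => (-1) ^ (G.level l + G.level m) * G.expKernel m l) (G.expKernel k)
      (fun m hm => by rw [G.expKernel_eq_zero_of_lt (by omega), mul_zero])
    have h2 : ∀ m, G.upperSum (fun m => (-1) ^ (G.level l + G.level m) * G.expKernel m l) m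
        = -((-1) ^ (G.level l + G.level m) *
            (((G.level l : ℝ) - G.level m) * G.expKernel m l)) := by
      intro m
      rw [← upperSum_expKernel_left, upperSum, upperSum, Finset.mul_sum, ← Finset.sum_neg_distrib]
      refine Finset.sum_congr rfl fun x hx => ?_
      rw [G.level_upper hx, ← add_assoc, pow_succ]
      ring
    simp only [lowerSum_expKernel, h2] at key
    rw [Finset.mul_sum, ← sub_eq_zero.2 key, ← Finset.sum_sub_distrib]
    exact Finset.sum_congr rfl fun m _ => by ring

/-! ### Self-duality as a commutation relation -/

section SelfDual

variable {G} {r : ℝ}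

theorem linearCombination_upOp {𝕜 : Type*} [RCLike 𝕜] (f : G.Vertex → ℝ) (v : G.Vertex →₀ 𝕜) :
    Finsupp.linearCombination 𝕜 (fun x => (f x : 𝕜)) (G.upOp 𝕜 v)
      = Finsupp.linearCombination 𝕜 (fun x => (G.upperSum f x : 𝕜)) v := by
  have : (Finsupp.linearCombination 𝕜 (fun x => (f x : 𝕜))) ∘ₗ G.upOp 𝕜
      = Finsupp.linearCombination 𝕜 (fun x => (G.upperSum f x : 𝕜)) := by
    ext y
    simp [upOp, upperSum]
  exact LinearMap.congr_fun this v

theorem linearCombination_downOp {𝕜 : Type*} [RCLike 𝕜] (f : G.Vertex → ℝ) (v : G.Vertex →₀ 𝕜) :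
    Finsupp.linearCombination 𝕜 (fun x => (f x : 𝕜)) (G.downOp 𝕜 v)
      = Finsupp.linearCombination 𝕜 (fun x => (G.lowerSum f x : 𝕜)) v := by
  have : (Finsupp.linearCombination 𝕜 (fun x => (f x : 𝕜))) ∘ₗ G.downOp 𝕜
      = Finsupp.linearCombination 𝕜 (fun x => (G.lowerSum f x : 𝕜)) := by
    ext y
    simp [downOp, lowerSum]
  exact LinearMap.congr_fun this v

/-- Pairing `[D°, U°] = r` on a basis vector with an arbitrary `f` extends the relation beyond
finite supports. Transposition both exchanges the roles of the operators and reverses their order,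
so the sign is unchanged. -/
theorem IsSelfDual.upperSum_lowerSum (hG : G.IsSelfDual r) (f : G.Vertex → ℝ) (y : G.Vertex) :
    G.upperSum (G.lowerSum f) y = G.lowerSum (G.upperSum f) y + r * f y := by
  have h := congrArg (Finsupp.linearCombination ℂ (fun x => (f x : ℂ)))
    (LinearMap.congr_fun hG (Finsupp.single y 1))
  rw [LinearMap.sub_apply, Module.End.mul_apply, Module.End.mul_apply, map_sub] at h
  have h1 := linearCombination_downOp f (G.upOp ℂ (Finsupp.single y 1))
  have h2 := linearCombination_upOp f (G.downOp ℂ (Finsupp.single y 1))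
  have h3 := linearCombination_upOp (G.lowerSum f) (Finsupp.single y (1 : ℂ))
  have h4 := linearCombination_downOp (G.upperSum f) (Finsupp.single y (1 : ℂ))
  simp only [Complex.coe_algebraMap] at h1 h2 h3 h4
  rw [h1, h2, h3, h4] at h
  simp only [Finsupp.linearCombination_single, LinearMap.smul_apply, Module.End.one_apply,
    map_smul, smul_eq_mul, one_mul] at h
  have h5 : G.upperSum (G.lowerSum f) y - G.lowerSum (G.upperSum f) y = r * f y := by
    exact_mod_cast h
  linarith

end SelfDual

theorem lowerSum_add (f g : G.Vertex → ℝ) (x : G.Vertex) :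
    G.lowerSum (fun y => f y + g y) x = G.lowerSum f x + G.lowerSum g x := by
  simp only [lowerSum, mul_add, Finset.sum_add_distrib]

theorem lowerSum_const_mul (c : ℝ) (f : G.Vertex → ℝ) (x : G.Vertex) :
    G.lowerSum (fun y => c * f y) x = c * G.lowerSum f x := by
  simp only [lowerSum, Finset.mul_sum]
  exact Finset.sum_congr rfl fun _ _ => by ring

variable {G} {r : ℝ}

/-- The commutation relation `D° exp(U°) = exp(U°) (D° + r)` in matrix form. -/
theorem IsSelfDual.upperSum_expKernel (hG : G.IsSelfDual r) (m y : G.Vertex) :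
    G.upperSum (G.expKernel m) y
      = r * G.expKernel m y + G.lowerSum (fun k => G.expKernel k y) m := by
  set P := G.upperSum (G.expKernel m) with hP
  set Q : G.Vertex → ℝ :=
    fun y => r * G.expKernel m y + G.lowerSum (fun k => G.expKernel k y) m with hQ
  -- Both sides of the claim satisfy the same first-order recursion in the level of `y`, which
  -- determines them once the factor |y| + 1 - |m| is nonzero.
  have hUP : ∀ y, G.lowerSum P y
      = ((G.level y : ℝ) + 1 - G.level m) * P y - r * G.expKernel m y := by
    intro y
    have h := hG.upperSum_lowerSum (G.expKernel m) y
    have h2 : G.upperSum (G.lowerSum (G.expKernel m)) y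
        = ((G.level y : ℝ) + 1 - G.level m) * P y := by
      rw [hP, upperSum, upperSum, Finset.mul_sum]
      refine Finset.sum_congr rfl fun x hx => ?_
      rw [lowerSum_expKernel, G.level_upper hx]
      push_cast
      ring
    linarith
  have hUQ : ∀ y, G.lowerSum Q y
      = ((G.level y : ℝ) + 1 - G.level m) * Q y - r * G.expKernel m y := by
    intro y
    have h2 : G.lowerSum (fun y => G.lowerSum (fun k => G.expKernel k y) m) y
        = ((G.level y : ℝ) + 1 - G.level m) * G.lowerSum (fun k => G.expKernel k y) m := by
      have : G.lowerSum (fun y => G.lowerSum (fun k => G.expKernel k y) m) y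
          = ∑ k ∈ G.lower m, G.mult k m * G.lowerSum (G.expKernel k) y := by
        simp only [lowerSum, Finset.mul_sum]
        rw [Finset.sum_comm]
        exact Finset.sum_congr rfl fun _ _ => Finset.sum_congr rfl fun _ _ => by ring
      rw [this, lowerSum, Finset.mul_sum]
      refine Finset.sum_congr rfl fun k hk => ?_
      rw [lowerSum_expKernel, G.level_lower hk]
      push_cast
      ring
    rw [hQ, lowerSum_add, lowerSum_const_mul, lowerSum_expKernel, h2]
    ring
  suffices H : ∀ n y, G.level y = n → P y = Q y from H _ y rfl
  intro n
  induction n using Nat.strong_induction_on with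
  | _ n ih =>
    intro y hy
    -- Below level |m| - 1 both sides vanish; at that level the recursion degenerates and both sides
    -- are the multiplicity of the edge from `y` to `m`, if any; above it the recursion applies.
    rcases lt_trichotomy (n + 1) (G.level m) with h | h | h
    · have h1 : P y = 0 := by
        refine Finset.sum_eq_zero fun x hx => ?_
        have := G.level_upper hx
        rw [G.expKernel_eq_zero_of_lt (by omega), mul_zero]
      have h2 : G.lowerSum (fun k => G.expKernel k y) m = 0 := by
        refine Finset.sum_eq_zero fun x hx => ?_
        have := G.level_lower hx
        dsimp only
        rw [G.expKernel_eq_zero_of_lt (by omega), mul_zero]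
      simp only [hQ]
      rw [h1, h2, G.expKernel_eq_zero_of_lt (by omega)]
      ring
    · have h1 : P y = if m ∈ G.upper y then G.mult y m else 0 := by
        rw [hP, upperSum, ← Finset.sum_ite_eq' (G.upper y) m (fun x => G.mult y x)]
        refine Finset.sum_congr rfl fun x hx => ?_
        have := G.level_upper hx
        split_ifs with hxm
        · subst hxm; rw [expKernel_self, mul_one]
        · rw [G.expKernel_eq_zero (by omega) (Ne.symm hxm), mul_zero]
      have h2 : G.lowerSum (fun k => G.expKernel k y) m
          = if y ∈ G.lower m then G.mult y m else 0 := by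
        rw [lowerSum, ← Finset.sum_ite_eq' (G.lower m) y (fun x => G.mult x m)]
        refine Finset.sum_congr rfl fun x hx => ?_
        have := G.level_lower hx
        split_ifs with hxm
        · subst hxm; rw [expKernel_self, mul_one]
        · rw [G.expKernel_eq_zero (by omega) hxm, mul_zero]
      simp only [hQ]
      rw [h1, h2, G.expKernel_eq_zero_of_lt (by omega), mul_zero, zero_add]
      simp only [mem_lower_iff_mem_upper]
    · have h1 : G.lowerSum P y = G.lowerSum Q y := by
        refine Finset.sum_congr rfl fun x hx => ?_
        have := G.level_lower hx
        rw [ih (G.level x) (by omega) x rfl]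
      rw [hUP, hUQ, sub_left_inj] at h1
      refine mul_left_cancel₀ ?_ h1
      have : (G.level m : ℝ) < G.level y + 1 := by rw [hy]; exact_mod_cast h
      linarith

/-! ### Scalar products of columns of exp U° on a level -/

/-- The coefficients `r ^ i / i!` of the exponential series, extended by zero. -/
def _root_.Real.expCoeff (r : ℝ) (i : ℤ) : ℝ := if 0 ≤ i then r ^ i.toNat / i.toNat.factorial else 0

theorem _root_.Real.mul_expCoeff (r : ℝ) (i : ℤ) :
    (i : ℝ) * Real.expCoeff r i = r * Real.expCoeff r (i - 1) := by
  rcases lt_trichotomy i 0 with h | rfl | h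
  · rw [Real.expCoeff, Real.expCoeff, if_neg (by omega), if_neg (by omega)]; ring
  · simp [Real.expCoeff]
  · obtain ⟨n, rfl⟩ : ∃ n : ℕ, i = n + 1 := ⟨(i - 1).toNat, by omega⟩
    rw [Real.expCoeff, Real.expCoeff, if_pos (by omega), if_pos (by omega),
      show ((n : ℤ) + 1).toNat = n + 1 by omega, show ((n : ℤ) + 1 - 1).toNat = n by omega,
      Nat.factorial_succ]
    have := Nat.factorial_ne_zero n
    push_cast
    field_simp
    ring

theorem _root_.Real.expCoeff_of_neg (r : ℝ) {i : ℤ} (h : i < 0) : Real.expCoeff r i = 0 :=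
  if_neg (by omega)

theorem _root_.Real.expCoeff_natCast (r : ℝ) (n : ℕ) :
    Real.expCoeff r n = r ^ n / n.factorial := by
  simp [Real.expCoeff]

/-- The component on level `n` of exp(D°) exp(U°) = e^r exp(U°) exp(D°). The integer index of
`Real.expCoeff` lets the terms with negative exponent vanish by themselves. -/
theorem IsSelfDual.sum_floor_expKernel (hG : G.IsSelfDual r) (N n : ℕ) (m k : G.Vertex)
    (hm : G.level m ≤ N) :
    ∑ x ∈ G.floor n, G.expKernel m x * G.expKernel k x
      = ∑ y ∈ G.ball N, Real.expCoeff r ((G.level y : ℤ) + n - G.level m - G.level k) *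
          (G.expKernel y m * G.expKernel y k) := by
  have base : ∀ (n : ℕ) (m : G.Vertex), G.level m ≤ N → n ≤ G.level k →
      ∑ x ∈ G.floor n, G.expKernel m x * G.expKernel k x
        = ∑ y ∈ G.ball N, Real.expCoeff r ((G.level y : ℤ) + n - G.level m - G.level k) *
          (G.expKernel y m * G.expKernel y k) := by
    intro n m hm hn
    rcases hn.lt_or_eq with h | h
    · rw [Finset.sum_eq_zero, Finset.sum_eq_zero]
      · intro y _
        rcases lt_or_ge (G.level m) (G.level y) with h2 | h2
        · rw [G.expKernel_eq_zero_of_lt h2]; ring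
        · rw [Real.expCoeff_of_neg r (by omega)]; ring
      · intro x hx
        rw [mem_floor] at hx
        rw [G.expKernel_eq_zero_of_lt (m := k) (by omega), mul_zero]
    · subst h
      rw [Finset.sum_eq_single_of_mem k (G.mem_floor.2 rfl),
        Finset.sum_eq_single_of_mem m (G.mem_ball.2 hm)]
      · simp [expKernel_self, Real.expCoeff]
      · intro y _ hy
        rcases le_or_gt (G.level m) (G.level y) with h2 | h2
        · rw [G.expKernel_eq_zero h2 hy]; ring
        · rw [Real.expCoeff_of_neg r (by omega)]; ring
      · intro x hx hxk
        rw [mem_floor] at hx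
        rw [G.expKernel_eq_zero hx.le (Ne.symm hxk), mul_zero]
  induction n generalizing m with
  | zero => exact base 0 m hm (Nat.zero_le _)
  | succ n ih' =>
    rcases le_or_gt (n + 1) (G.level k) with h | h
    · exact base (n + 1) m hm h
    -- The factor n + 1 - |k| is what U° produces from E(k, ·) on level n + 1. Transposed, it is D°
    -- acting on E(m, ·), and the commutation relation leads back to level n with `m` or its lower
    -- neighbours.
    · have hne : ((n + 1 : ℕ) : ℝ) - G.level k ≠ 0 := by
        rw [sub_ne_zero]; exact_mod_cast h.ne'
      refine mul_left_cancel₀ hne ?_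
      have h1 : ((n + 1 : ℕ) - G.level k : ℝ) *
          ∑ x ∈ G.floor (n + 1), G.expKernel m x * G.expKernel k x
          = r * ∑ x ∈ G.floor n, G.expKernel m x * G.expKernel k x
            + G.lowerSum (fun l => ∑ x ∈ G.floor n, G.expKernel l x * G.expKernel k x) m := by
        have key := G.sum_floor_mul_lowerSum n (G.expKernel m) (G.expKernel k)
        have h2 : ∑ x ∈ G.floor (n + 1), G.expKernel m x * G.lowerSum (G.expKernel k) x
            = ((n + 1 : ℕ) - G.level k : ℝ) *
              ∑ x ∈ G.floor (n + 1), G.expKernel m x * G.expKernel k x := by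
          rw [Finset.mul_sum]
          refine Finset.sum_congr rfl fun x hx => ?_
          rw [lowerSum_expKernel, G.mem_floor.1 hx]
          ring
        rw [← h2, key, Finset.mul_sum, lowerSum]
        simp only [Finset.mul_sum]
        rw [Finset.sum_comm, ← Finset.sum_add_distrib]
        refine Finset.sum_congr rfl fun y _ => ?_
        rw [hG.upperSum_expKernel, add_mul, lowerSum, Finset.sum_mul]
        congr 1
        · ring
        · exact Finset.sum_congr rfl fun _ _ => by ring
      have h3 : G.lowerSum (fun l => ∑ x ∈ G.floor n, G.expKernel l x * G.expKernel k x) m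
          = ∑ y ∈ G.ball N, Real.expCoeff r ((G.level y : ℤ) + (n + 1 : ℕ) - G.level m - G.level k)
            * (((G.level m : ℝ) - G.level y) * G.expKernel y m * G.expKernel y k) := by
        have : G.lowerSum (fun l => ∑ x ∈ G.floor n, G.expKernel l x * G.expKernel k x) m
            = ∑ l ∈ G.lower m, ∑ y ∈ G.ball N, G.mult l m *
              (Real.expCoeff r ((G.level y : ℤ) + (n + 1 : ℕ) - G.level m - G.level k) *
                (G.expKernel y l * G.expKernel y k)) := by
          refine Finset.sum_congr rfl fun l hl => ?_
          have hlm := G.level_lower hl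
          dsimp only
          rw [ih' l (by omega), Finset.mul_sum]
          refine Finset.sum_congr rfl fun y _ => ?_
          rw [hlm]
          congr 3
          push_cast
          ring
        rw [this, Finset.sum_comm]
        refine Finset.sum_congr rfl fun y _ => ?_
        rw [← lowerSum_expKernel, lowerSum, Finset.sum_mul, Finset.mul_sum]
        exact Finset.sum_congr rfl fun _ _ => by ring
      rw [h1, h3, ih' m hm, Finset.mul_sum, ← Finset.sum_add_distrib, Finset.mul_sum]
      refine Finset.sum_congr rfl fun y _ => ?_
      have h4 := Real.mul_expCoeff r
        ((G.level y : ℤ) + (n + 1 : ℕ) - G.level m - G.level k)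
      rw [show (G.level y : ℤ) + (n + 1 : ℕ) - G.level m - G.level k - 1
        = (G.level y : ℤ) + n - G.level m - G.level k by push_cast; ring] at h4
      push_cast at h4 ⊢
      linear_combination (-(G.expKernel y m * G.expKernel y k)) * h4

end BranchingGraph

namespace BranchingGraph

/-! ### Explicit form of the Plancherel measures -/

section Plancherel

variable (G : BranchingGraph.{u})

theorem linearCombination_upOp_pow (n : ℕ) (f : G.Vertex → ℝ) (v : G.Vertex →₀ ℝ) :
    Finsupp.linearCombination ℝ f ((G.upOp ℝ ^ n) v)
      = Finsupp.linearCombination ℝ (G.upperSum^[n] f) v := by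
  induction n generalizing f with
  | zero => simp
  | succ n ih =>
    rw [pow_succ', Module.End.mul_apply, Function.iterate_succ_apply, ← ih]
    exact linearCombination_upOp (𝕜 := ℝ) f _

theorem linearCombination_downOp_pow (n : ℕ) (f : G.Vertex → ℝ) (v : G.Vertex →₀ ℝ) :
    Finsupp.linearCombination ℝ f ((G.downOp ℝ ^ n) v)
      = Finsupp.linearCombination ℝ (G.lowerSum^[n] f) v := by
  induction n generalizing f with
  | zero => simp
  | succ n ih =>
    rw [pow_succ', Module.End.mul_apply, Function.iterate_succ_apply, ← ih]
    exact linearCombination_downOp (𝕜 := ℝ) f _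

theorem iterate_upperSum_single (n : ℕ) (l y : G.Vertex) :
    G.upperSum^[n] (Pi.single l 1) y = if G.level y + n = G.level l then G.relDim y l else 0 := by
  induction n generalizing y with
  | zero =>
    rw [Function.iterate_zero, id, Pi.single_apply, add_zero]
    by_cases h : y = l
    · subst h; simp [relDim_self]
    · rw [if_neg h]
      split_ifs with h2
      · rw [G.relDim_eq_zero h2.ge h]
      · rfl
  | succ n ih =>
    rw [Function.iterate_succ_apply']
    split_ifs with h
    · rw [relDim_eq_ite_add_upperSum, if_neg (by rintro rfl; omega), zero_add]
      refine Finset.sum_congr rfl fun x hx => ?_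
      have := G.level_upper hx
      rw [ih, if_pos (by omega)]
    · refine Finset.sum_eq_zero fun x hx => ?_
      have := G.level_upper hx
      rw [ih, if_neg (by omega), mul_zero]

theorem iterate_lowerSum_single (n : ℕ) (y : G.Vertex) :
    G.lowerSum^[n] (Pi.single G.root 1) y = if G.level y = n then G.dim y else 0 := by
  induction n generalizing y with
  | zero =>
    rw [Function.iterate_zero, id, Pi.single_apply]
    by_cases h : y = G.root
    · subst h; simp [dim, relDim_self, level_root]
    · rw [if_neg h, if_neg fun h2 => h ((G.level_eq_zero_iff y).1 h2)]
  | succ n ih =>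
    rw [Function.iterate_succ_apply']
    split_ifs with h
    · rw [dim, relDim_eq_ite_add_lowerSum,
        if_neg (by rintro rfl; rw [level_root] at h; omega), zero_add]
      refine Finset.sum_congr rfl fun x hx => ?_
      have := G.level_lower hx
      rw [ih, if_pos (by omega), dim]
    · refine Finset.sum_eq_zero fun x hx => ?_
      have := G.level_lower hx
      rw [ih, if_neg (by omega), mul_zero]

theorem linearCombination_single_one (l : G.Vertex) (v : G.Vertex →₀ ℝ) :
    Finsupp.linearCombination ℝ (Pi.single l (1 : ℝ)) v = v l := by
  simpa [Finsupp.linearCombination_apply, Finsupp.sum, Pi.single_apply] using Eq.symm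

theorem plancherelWeight_level (l : G.Vertex) :
    G.plancherelWeight (G.level l) l = G.dim l ^ 2 := by
  rw [plancherelWeight, ← linearCombination_single_one, linearCombination_upOp_pow,
    ← G.linearCombination_single_one G.root, linearCombination_downOp_pow,
    Finsupp.linearCombination_single, Finsupp.linearCombination_single, iterate_upperSum_single,
    iterate_lowerSum_single, if_pos rfl, level_root, zero_add, if_pos rfl, sq, dim]
  simp

variable {G} {r γ : ℝ}

/-- The normalizing constant: the level formula with both vertices at the root, where y = ∅ is the
only term. -/
theorem IsSelfDual.sum_floor_dim_sq (hG : G.IsSelfDual r) (n : ℕ) :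
    ∑ x ∈ G.floor n, G.dim x ^ 2 = r ^ n * n.factorial := by
  have h := hG.sum_floor_expKernel 0 n G.root G.root (by rw [level_root])
  have h0 : G.ball 0 = {G.root} := by
    ext x
    rw [mem_ball, Nat.le_zero, level_eq_zero_iff, Finset.mem_singleton]
  rw [h0, Finset.sum_singleton, expKernel_self, level_root] at h
  simp only [Nat.cast_zero, zero_add, sub_zero, mul_one, Real.expCoeff_natCast] at h
  have h1 : ∑ x ∈ G.floor n, G.expKernel G.root x * G.expKernel G.root x
      = (∑ x ∈ G.floor n, G.dim x ^ 2) / (n.factorial : ℝ) ^ 2 := by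
    rw [Finset.sum_div]
    refine Finset.sum_congr rfl fun x hx => ?_
    rw [expKernel_root, G.mem_floor.1 hx]
    ring
  rw [h1] at h
  have := Nat.factorial_ne_zero n
  field_simp at h
  linarith

theorem IsSelfDual.plancherel_level (hG : G.IsSelfDual r) (l : G.Vertex) :
    G.plancherel (G.level l) l = G.dim l ^ 2 / (r ^ G.level l * (G.level l).factorial) := by
  rw [plancherel, plancherelWeight_level, ← hG.sum_floor_dim_sq]
  congr 1
  refine Finset.sum_congr rfl fun x hx => ?_
  rw [← G.mem_floor.1 hx, plancherelWeight_level]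

theorem IsSelfDual.poissonPlancherel_eq (hG : G.IsSelfDual r) (hr : 0 < r) (l : G.Vertex) :
    G.poissonPlancherel r γ l
      = Real.exp (-(γ * r)) * γ ^ G.level l * (G.dim l / (G.level l).factorial) ^ 2 := by
  rw [poissonPlancherel, hG.plancherel_level]
  have := Nat.factorial_ne_zero (G.level l)
  rw [mul_pow]
  field_simp

theorem IsSelfDual.poissonPlancherel_pos (hG : G.IsSelfDual r) (hr : 0 < r) (hγ : 0 < γ)
    (l : G.Vertex) : 0 < G.poissonPlancherel r γ l := by
  rw [hG.poissonPlancherel_eq hr]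
  have := G.dim_pos l
  positivity

end Plancherel

/-! ### Generating functions over the levels and the symmetric kernel -/

section Sums

variable {G : BranchingGraph.{u}} {r : ℝ}

theorem hasSum_of_hasSum_floor {f : G.Vertex → ℝ} (hf : ∀ x, 0 ≤ f x) {a : ℝ}
    (h : HasSum (fun n => ∑ x ∈ G.floor n, f x) a) : HasSum f a := by
  have hfl : ∀ n, HasSum (fun x : {x : G.Vertex // G.level x = n} => f x)
      (∑ x ∈ G.floor n, f x) := by
    intro n
    have : Fintype {x : G.Vertex // G.level x = n} := (G.finite_level n).fintype
    have h2 := hasSum_fintype (fun x : {x : G.Vertex // G.level x = n} => f x)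
    rwa [← Finset.sum_subtype (G.floor n) (fun x => G.mem_floor)] at h2
  rw [← (Equiv.sigmaFiberEquiv G.level).hasSum_iff]
  have hs : Summable (f ∘ Equiv.sigmaFiberEquiv G.level) := by
    refine (summable_sigma_of_nonneg fun _ => hf _).2 ⟨fun n => (hfl n).summable, ?_⟩
    refine h.summable.congr fun n => ?_
    exact ((hfl n).tsum_eq).symm
  have h3 := hs.hasSum.sigma (f := f ∘ Equiv.sigmaFiberEquiv G.level) (fun n => hfl n)
  rw [← h3.unique h]
  exact hs.hasSum

theorem _root_.Real.hasSum_pow_mul_expCoeff (r t : ℝ) (j : ℕ) :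
    HasSum (fun n : ℕ => t ^ n * Real.expCoeff r ((n : ℤ) - j)) (t ^ j * Real.exp (t * r)) := by
  rw [← hasSum_nat_add_iff' j, Finset.sum_eq_zero, sub_zero]
  · have h : HasSum (fun n : ℕ => (t * r) ^ n / n.factorial) (Real.exp (t * r)) := by
      rw [Real.exp_eq_exp_ℝ]
      exact NormedSpace.expSeries_div_hasSum_exp (t * r)
    refine (h.mul_left (t ^ j)).congr_fun fun n => ?_
    rw [Nat.cast_add, add_sub_cancel_right, Real.expCoeff_natCast]
    ring
  · intro i hi
    rw [Finset.mem_range] at hi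
    rw [Real.expCoeff_of_neg r (by omega), mul_zero]

/-- The generating function of the scalar products of the columns of `exp U°` on the levels. -/
theorem IsSelfDual.hasSum_expKernel (hG : G.IsSelfDual r) {t : ℝ} (ht : 0 < t) (N : ℕ)
    (m k : G.Vertex) (hm : G.level m ≤ N) :
    HasSum (fun x => t ^ G.level x * (G.expKernel m x * G.expKernel k x))
      (Real.exp (t * r) * ∑ y ∈ G.ball N, t ^ G.level m * t ^ G.level k * t⁻¹ ^ G.level y *
        (G.expKernel y m * G.expKernel y k)) := by
  refine hasSum_of_hasSum_floor (fun x => mul_nonneg (by positivity)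
    (mul_nonneg (G.expKernel_nonneg _ _) (G.expKernel_nonneg _ _))) ?_
  have h1 : ∀ n, ∑ x ∈ G.floor n, t ^ G.level x * (G.expKernel m x * G.expKernel k x)
      = ∑ y ∈ G.ball N, t ^ n * Real.expCoeff r ((G.level y : ℤ) + n - G.level m - G.level k) *
          (G.expKernel y m * G.expKernel y k) := by
    intro n
    simp only [mul_assoc (t ^ n)]
    rw [← Finset.mul_sum, ← hG.sum_floor_expKernel N n m k hm, Finset.mul_sum]
    exact Finset.sum_congr rfl fun x hx => by rw [G.mem_floor.1 hx]
  simp only [h1]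
  rw [Finset.mul_sum]
  refine hasSum_sum fun y _ => ?_
  rcases lt_or_ge (G.level m) (G.level y) with h | h
  · simp [G.expKernel_eq_zero_of_lt h]
  rw [← mul_assoc]
  refine HasSum.mul_right _ ?_
  -- Here |y| ≤ |m|, so the subtraction of natural numbers is not truncated.
  have h2 := Real.hasSum_pow_mul_expCoeff r t (G.level m + G.level k - G.level y)
  have h3 : Real.exp (t * r) * (t ^ G.level m * t ^ G.level k * t⁻¹ ^ G.level y)
      = t ^ (G.level m + G.level k - G.level y) * Real.exp (t * r) := by
    rw [pow_sub₀ _ ht.ne' (by omega), pow_add, inv_pow]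
    ring
  rw [h3]
  refine h2.congr_fun fun n => ?_
  congr 2
  omega

/-- The symmetric kernel which is, up to elementary factors, the family of the functions
`charlierFun`. -/
def charlierKernel (G : BranchingGraph.{u}) (a : ℝ) (l x : G.Vertex) : ℝ :=
  ∑ m ∈ G.ball (G.level l), a ^ G.level m * (G.expKernel m l * G.expKernel m x)

theorem charlierKernel_eq (a : ℝ) {l x : G.Vertex} {N : ℕ} (h : G.level l ≤ N) :
    G.charlierKernel a l x
      = ∑ m ∈ G.ball N, a ^ G.level m * (G.expKernel m l * G.expKernel m x) := by
  refine Finset.sum_subset (fun m hm => ?_) fun m _ hm => ?_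
  · rw [mem_ball] at hm ⊢; omega
  · rw [mem_ball, not_le] at hm
    rw [G.expKernel_eq_zero_of_lt hm]; ring

/-- The self-duality of Charlier functions: argument and index may be exchanged. This makes
completeness a consequence of orthogonality. -/
theorem charlierKernel_comm (a : ℝ) (l x : G.Vertex) :
    G.charlierKernel a l x = G.charlierKernel a x l := by
  rw [charlierKernel_eq a (le_max_left (G.level l) (G.level x)),
    charlierKernel_eq a (le_max_right (G.level l) (G.level x))]
  exact Finset.sum_congr rfl fun _ _ => by ring

theorem IsSelfDual.hasSum_charlierKernel (hG : G.IsSelfDual r) {γ : ℝ} (hγ : 0 < γ)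
    (l k : G.Vertex) :
    HasSum (fun x => γ ^ G.level x *
        (G.charlierKernel (-γ)⁻¹ l x * G.charlierKernel (-γ)⁻¹ k x))
      (if l = k then Real.exp (γ * r) * γ⁻¹ ^ G.level l else 0) := by
  set N := max (G.level l) (G.level k)
  have hl : G.level l ≤ N := le_max_left _ _
  have hk : G.level k ≤ N := le_max_right _ _
  set a := (-γ)⁻¹ with ha
  have haγ : a * γ = -1 := by rw [ha]; field_simp
  have h1 : HasSum (fun x => γ ^ G.level x * (G.charlierKernel a l x * G.charlierKernel a k x))
      (∑ m ∈ G.ball N, ∑ n ∈ G.ball N, a ^ G.level m * G.expKernel m l *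
        (a ^ G.level n * G.expKernel n k) * (Real.exp (γ * r) * ∑ y ∈ G.ball N,
          γ ^ G.level m * γ ^ G.level n * γ⁻¹ ^ G.level y *
            (G.expKernel y m * G.expKernel y n))) := by
    have h2 := hasSum_sum (s := G.ball N) fun m hm => hasSum_sum (s := G.ball N) fun n _ =>
      (hG.hasSum_expKernel hγ N m n (G.mem_ball.1 hm)).mul_left
        (a ^ G.level m * G.expKernel m l * (a ^ G.level n * G.expKernel n k))
    refine h2.congr_fun fun x => ?_
    rw [charlierKernel_eq a hl, charlierKernel_eq a hk, Finset.sum_mul_sum, Finset.mul_sum]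
    refine Finset.sum_congr rfl fun m _ => ?_
    rw [Finset.mul_sum]
    exact Finset.sum_congr rfl fun n _ => by ring
  convert h1 using 1
  -- After the powers of γ and -1/γ merge into signs, the sums over `m` and over `n` are entries of
  -- exp(-U°) exp(U°) = 1, up to a sign.
  have h3 : ∀ (j y : G.Vertex), G.level j ≤ N →
      ∑ m ∈ G.ball N, (-1) ^ G.level m * G.expKernel m j * G.expKernel y m
        = (-1) ^ G.level j * if y = j then 1 else 0 := by
    intro j y hj
    rw [← G.sum_neg_one_pow_mul_expKernel N y j hj, Finset.mul_sum]
    refine Finset.sum_congr rfl fun m _ => ?_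
    rw [pow_add, ← mul_assoc, ← mul_assoc, ← mul_assoc, ← mul_pow, neg_one_mul, neg_neg, one_pow,
      one_mul]
  have h4 : ∑ m ∈ G.ball N, ∑ n ∈ G.ball N, a ^ G.level m * G.expKernel m l *
        (a ^ G.level n * G.expKernel n k) * (Real.exp (γ * r) * ∑ y ∈ G.ball N,
          γ ^ G.level m * γ ^ G.level n * γ⁻¹ ^ G.level y * (G.expKernel y m * G.expKernel y n))
      = Real.exp (γ * r) * ∑ y ∈ G.ball N, γ⁻¹ ^ G.level y *
        ((∑ m ∈ G.ball N, (-1) ^ G.level m * G.expKernel m l * G.expKernel y m) *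
          ∑ n ∈ G.ball N, (-1) ^ G.level n * G.expKernel n k * G.expKernel y n) := by
    simp only [Finset.sum_mul, Finset.mul_sum]
    rw [Finset.sum_comm]
    symm
    rw [Finset.sum_comm]
    refine Finset.sum_congr rfl fun n _ => ?_
    rw [Finset.sum_comm]
    refine Finset.sum_congr rfl fun m _ => Finset.sum_congr rfl fun y _ => ?_
    rw [← haγ, mul_pow, mul_pow]
    ring
  rw [h4, Finset.sum_congr rfl fun y _ => by rw [h3 l y hl, h3 k y hk],
    Finset.sum_eq_single_of_mem l (G.mem_ball.2 hl)]
  · rw [if_pos (rfl : l = l)]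
    split_ifs with h
    · subst h
      rw [mul_one, ← mul_pow, neg_one_mul, neg_neg, one_pow, mul_one]
    · ring
  · intro y _ hy
    rw [if_neg hy]; ring

end Sums

/-! ### Orthogonality and dual orthogonality of the functions C_l -/

section Charlier

variable {G : BranchingGraph.{u}} {r γ : ℝ}

theorem relDimFun_eq (m x : G.Vertex) :
    G.relDimFun m x = (G.level x).factorial / G.dim x * G.expKernel m x := by
  rw [relDimFun, expKernel]
  rcases le_or_gt (G.level m) (G.level x) with h | h
  · rw [← Nat.factorial_mul_descFactorial h]
    have := Nat.factorial_ne_zero (G.level x - G.level m)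
    have := (G.dim_pos x).ne'
    push_cast
    field_simp
  · rw [G.relDim_eq_zero h.le (by rintro rfl; omega)]
    simp

theorem charlierFun_eq_sum (l x : G.Vertex) :
    G.charlierFun γ l x = ∑ m ∈ G.ball (G.level l),
      (-γ) ^ (G.level l - G.level m) * G.expKernel m l * G.relDimFun m x := by
  rw [charlierFun, below, Finset.sum_filter]
  refine Finset.sum_congr rfl fun m _ => ?_
  split_ifs with h
  · rfl
  · rw [not_not] at h
    simp [expKernel, h]

theorem charlierFun_eq (hγ : γ ≠ 0) (l x : G.Vertex) :
    G.charlierFun γ l x = (-γ) ^ G.level l * ((G.level x).factorial / G.dim x) *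
      G.charlierKernel (-γ)⁻¹ l x := by
  rw [charlierFun_eq_sum, charlierKernel, Finset.mul_sum]
  refine Finset.sum_congr rfl fun m hm => ?_
  rw [relDimFun_eq, pow_sub₀ _ (neg_ne_zero.2 hγ) (G.mem_ball.1 hm), inv_pow]
  ring

theorem IsSelfDual.poissonPlancherel_mul (hG : G.IsSelfDual r) (hr : 0 < r) (x : G.Vertex) :
    G.poissonPlancherel r γ x * ((G.level x).factorial / G.dim x) ^ 2
      = Real.exp (-(γ * r)) * γ ^ G.level x := by
  rw [hG.poissonPlancherel_eq hr]
  have := Nat.factorial_ne_zero (G.level x)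
  have := (G.dim_pos x).ne'
  field_simp

theorem IsSelfDual.hasSum_charlierFun (hG : G.IsSelfDual r) (hr : 0 < r) (hγ : 0 < γ)
    (l k : G.Vertex) :
    HasSum (fun x => G.poissonPlancherel r γ x * (G.charlierFun γ l x * G.charlierFun γ k x))
      (if l = k then γ ^ G.level l else 0) := by
  have h := (hG.hasSum_charlierKernel hγ l k).mul_left
    (Real.exp (-(γ * r)) * ((-γ) ^ G.level l * (-γ) ^ G.level k))
  have h2 : Real.exp (-(γ * r)) * ((-γ) ^ G.level l * (-γ) ^ G.level k) *
      (if l = k then Real.exp (γ * r) * γ⁻¹ ^ G.level l else 0)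
      = if l = k then γ ^ G.level l else 0 := by
    split_ifs with h
    · subst h
      rw [← mul_pow, neg_mul_neg, mul_pow, Real.exp_neg, inv_pow]
      field_simp
    · simp
  rw [h2] at h
  refine h.congr_fun fun x => ?_
  rw [charlierFun_eq hγ.ne', charlierFun_eq hγ.ne']
  linear_combination ((-γ) ^ G.level l * (-γ) ^ G.level k * G.charlierKernel (-γ)⁻¹ l x *
    G.charlierKernel (-γ)⁻¹ k x) * hG.poissonPlancherel_mul (γ := γ) hr x

/-- The dual orthogonality relation (on the diagonal). -/
theorem IsSelfDual.hasSum_charlierFun_dual (hG : G.IsSelfDual r) (hr : 0 < r) (hγ : 0 < γ)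
    (x : G.Vertex) :
    HasSum (fun l => γ⁻¹ ^ G.level l * (G.poissonPlancherel r γ x * G.charlierFun γ l x) ^ 2)
      (G.poissonPlancherel r γ x) := by
  have h := (hG.hasSum_charlierKernel hγ x x).mul_left
    (G.poissonPlancherel r γ x ^ 2 * ((G.level x).factorial / G.dim x) ^ 2)
  have h0 := hG.poissonPlancherel_mul (γ := γ) hr x
  have h2 : G.poissonPlancherel r γ x ^ 2 * ((G.level x).factorial / G.dim x) ^ 2 *
      (if x = x then Real.exp (γ * r) * γ⁻¹ ^ G.level x else 0) = G.poissonPlancherel r γ x := by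
    rw [if_pos rfl, sq, mul_assoc (G.poissonPlancherel r γ x), h0, Real.exp_neg, inv_pow]
    field_simp
  rw [h2] at h
  refine h.congr_fun fun l => ?_
  have h3 : γ⁻¹ ^ G.level l * ((-γ) ^ G.level l) ^ 2 = γ ^ G.level l := by
    rw [← pow_mul, mul_comm (G.level l), pow_mul, neg_sq, ← mul_pow]
    congr 1
    field_simp
  -- The symmetry of the kernel turns the sum over the argument into a sum over the index.
  rw [charlierFun_eq hγ.ne', charlierKernel_comm, ← h3]
  ring

/-- The functions `P*_m` are square integrable, even after multiplication by the level. -/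
theorem IsSelfDual.summable_level_mul_relDimFun (hG : G.IsSelfDual r) (hr : 0 < r) (hγ : 0 < γ)
    (m : G.Vertex) :
    Summable fun x => G.poissonPlancherel r γ x *
      (((G.level x : ℝ) + 1) * G.relDimFun m x) ^ 2 := by
  -- The generating function converges for every positive parameter; replacing γ by 4γ leaves room
  -- for (|x| + 1)² ≤ 4^|x|.
  have h := ((hG.hasSum_expKernel (t := 4 * γ) (by positivity) _ m m le_rfl).mul_left
    (Real.exp (-(γ * r)))).summable
  refine Summable.of_nonneg_of_le (fun x => ?_) (fun x => ?_) h
  · have := (hG.poissonPlancherel_pos hr hγ x).le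
    positivity
  · have h1 : ((G.level x : ℝ) + 1) ^ 2 ≤ 4 ^ G.level x := by
      rw [show (4 : ℝ) = 2 ^ 2 by norm_num, ← pow_mul, mul_comm 2, pow_mul]
      have : G.level x + 1 ≤ 2 ^ G.level x := Nat.lt_two_pow_self
      have : (G.level x : ℝ) + 1 ≤ 2 ^ G.level x := by exact_mod_cast this
      gcongr
    have h2 := hG.poissonPlancherel_mul (γ := γ) hr x
    calc _ = (G.poissonPlancherel r γ x * ((G.level x).factorial / G.dim x) ^ 2) *
          ((G.level x : ℝ) + 1) ^ 2 * G.expKernel m x ^ 2 := by rw [relDimFun_eq]; ring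
      _ ≤ Real.exp (-(γ * r)) * γ ^ G.level x * 4 ^ G.level x * G.expKernel m x ^ 2 := by
          rw [h2]; gcongr
      _ = _ := by rw [mul_pow]; ring

end Charlier

end BranchingGraph

/-! ### Parseval's identity and closed spans -/

open Filter Topology

/-- A vector for which Parseval's identity with respect to an orthonormal family holds belongs to
the closed span of the family. -/
theorem Orthonormal.mem_closure_span_of_hasSum {ι H : Type*} [NormedAddCommGroup H]
    [InnerProductSpace ℂ H] {v : ι → H} (hv : Orthonormal ℂ v) (x : H)
    (h : HasSum (fun i => ‖inner ℂ (v i) x‖ ^ 2) (‖x‖ ^ 2)) :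
    x ∈ (Submodule.span ℂ (Set.range v)).topologicalClosure := by
  have hdist : ∀ s : Finset ι, ‖x - ∑ i ∈ s, inner ℂ (v i) x • v i‖ ^ 2
      = ‖x‖ ^ 2 - ∑ i ∈ s, ‖inner ℂ (v i) x‖ ^ 2 := by
    intro s
    have h1 : inner ℂ x (∑ i ∈ s, inner ℂ (v i) x • v i)
        = ((∑ i ∈ s, ‖inner ℂ (v i) x‖ ^ 2 : ℝ) : ℂ) := by
      rw [inner_sum]
      push_cast
      refine Finset.sum_congr rfl fun i _ => ?_
      rw [inner_smul_right, ← inner_conj_symm x (v i), RCLike.mul_conj]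
      rfl
    have h2 : ‖∑ i ∈ s, inner ℂ (v i) x • v i‖ ^ 2 = ∑ i ∈ s, ‖inner ℂ (v i) x‖ ^ 2 := by
      have h3 := hv.inner_sum (fun i => inner ℂ (v i) x) (fun i => inner ℂ (v i) x) s
      rw [inner_self_eq_norm_sq_to_K] at h3
      have h4 : ((‖∑ i ∈ s, inner ℂ (v i) x • v i‖ ^ 2 : ℝ) : ℂ)
          = ((∑ i ∈ s, ‖inner ℂ (v i) x‖ ^ 2 : ℝ) : ℂ) := by
        push_cast
        refine h3.trans (Finset.sum_congr rfl fun i _ => ?_)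
        rw [RCLike.conj_mul]
        rfl
      exact_mod_cast h4
    rw [@norm_sub_sq ℂ, h1, h2]
    simp only [RCLike.re_to_complex, Complex.ofReal_re]
    ring
  have htend : Tendsto (fun s : Finset ι => ∑ i ∈ s, inner ℂ (v i) x • v i) atTop (𝓝 x) := by
    rw [tendsto_iff_norm_sub_tendsto_zero]
    have h5 : Tendsto (fun s : Finset ι => ‖x - ∑ i ∈ s, inner ℂ (v i) x • v i‖ ^ 2)
        atTop (𝓝 0) := by
      simp only [hdist]
      have h6 : Tendsto (fun s : Finset ι => ∑ i ∈ s, ‖inner ℂ (v i) x‖ ^ 2) atTop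
        (𝓝 (‖x‖ ^ 2)) := h
      have h8 := h6.const_sub (‖x‖ ^ 2)
      rwa [sub_self (‖x‖ ^ 2)] at h8
    have h7 := h5.sqrt
    simp only [Real.sqrt_zero] at h7
    refine h7.congr fun s => ?_
    rw [Real.sqrt_sq (norm_nonneg _), norm_sub_rev]
  refine mem_closure_of_tendsto htend (Eventually.of_forall fun s => ?_)
  exact Submodule.sum_mem _ fun i _ =>
    Submodule.smul_mem _ _ (Submodule.subset_span (Set.mem_range_self i))

namespace BranchingGraph

variable {G : BranchingGraph.{u}} {r γ : ℝ}

/-! ### The space ℓ² as a space of genuine functions -/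

section Hilbert

instance : Countable G.Vertex := by
  have h : (⋃ n, {l : G.Vertex | G.level l = n}) = Set.univ := by
    ext l
    simp
  rw [← Set.countable_univ_iff, ← h]
  exact Set.countable_iUnion fun n => (G.finite_level n).countable

/-- Every vertex is an atom of positive mass, so almost everywhere means everywhere and classes in
`ell2` have well-defined values. -/
theorem IsSelfDual.ae_iff (hG : G.IsSelfDual r) (hr : 0 < r) (hγ : 0 < γ) {p : G.Vertex → Prop} :
    (∀ᵐ x ∂G.poissonPlancherelMeasure r γ, p x) ↔ ∀ x, p x := by
  rw [poissonPlancherelMeasure, Measure.ae_sum_iff' (MeasurableSet.of_discrete)]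
  refine forall_congr' fun x => ?_
  rw [Measure.ae_ennreal_smul_measure_iff
    (ENNReal.ofReal_pos.2 (hG.poissonPlancherel_pos hr hγ x)).ne', ae_dirac_eq]
  exact Filter.eventually_pure

theorem IsSelfDual.integral_eq (hG : G.IsSelfDual r) (hr : 0 < r) (hγ : 0 < γ)
    (f : G.Vertex → ℂ) :
    ∫ x, f x ∂G.poissonPlancherelMeasure r γ = ∑' x, (G.poissonPlancherel r γ x : ℂ) * f x := by
  rw [poissonPlancherelMeasure, integral_sum_dirac fun _ => ENNReal.ofReal_ne_top]
  refine tsum_congr fun x => ?_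
  rw [ENNReal.toReal_ofReal (hG.poissonPlancherel_pos hr hγ x).le, Complex.real_smul]

theorem IsSelfDual.memLp_of_summable (hG : G.IsSelfDual r) (hr : 0 < r) (hγ : 0 < γ)
    {f : G.Vertex → ℂ} (hf : Summable fun x => G.poissonPlancherel r γ x * ‖f x‖ ^ 2) :
    MemLp f 2 (G.poissonPlancherelMeasure r γ) := by
  have hm : AEStronglyMeasurable f (G.poissonPlancherelMeasure r γ) :=
    (Measurable.of_discrete (f := f)).aestronglyMeasurable
  rw [memLp_two_iff_integrable_sq_norm hm]
  refine integrable_sum_dirac (fun _ => ENNReal.ofReal_ne_top) ?_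
  refine hf.congr fun x => ?_
  rw [ENNReal.toReal_ofReal (hG.poissonPlancherel_pos hr hγ x).le, Real.norm_of_nonneg (sq_nonneg _)]

theorem IsSelfDual.memLp_of_le (hG : G.IsSelfDual r) (hr : 0 < r) (hγ : 0 < γ)
    {f : G.Vertex → ℂ} {b : G.Vertex → ℝ} (hfb : ∀ x, ‖f x‖ ≤ b x)
    (hb : Summable fun x => G.poissonPlancherel r γ x * b x ^ 2) :
    MemLp f 2 (G.poissonPlancherelMeasure r γ) := by
  refine hG.memLp_of_summable hr hγ (Summable.of_nonneg_of_le (fun x => ?_) (fun x => ?_) hb)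
  · have := (hG.poissonPlancherel_pos hr hγ x).le
    positivity
  · have := (hG.poissonPlancherel_pos hr hγ x).le
    have := hfb x
    gcongr

theorem IsSelfDual.coe_toLp (hG : G.IsSelfDual r) (hr : 0 < r) (hγ : 0 < γ)
    {f : G.Vertex → ℂ} (hf : MemLp f 2 (G.poissonPlancherelMeasure r γ)) (x : G.Vertex) :
    (hf.toLp : G.ell2 r γ) x = f x :=
  (hG.ae_iff hr hγ).1 hf.coeFn_toLp x

theorem IsSelfDual.ell2_ext (hG : G.IsSelfDual r) (hr : 0 < r) (hγ : 0 < γ)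
    {f g : G.ell2 r γ} (h : ∀ x, f x = g x) : f = g :=
  Lp.ext ((hG.ae_iff hr hγ).2 h)

theorem IsSelfDual.coe_sub (hG : G.IsSelfDual r) (hr : 0 < r) (hγ : 0 < γ)
    (f g : G.ell2 r γ) (x : G.Vertex) : (f - g) x = f x - g x :=
  (hG.ae_iff hr hγ).1 (Lp.coeFn_sub f g) x

theorem IsSelfDual.coe_add (hG : G.IsSelfDual r) (hr : 0 < r) (hγ : 0 < γ)
    (f g : G.ell2 r γ) (x : G.Vertex) : (f + g) x = f x + g x :=
  (hG.ae_iff hr hγ).1 (Lp.coeFn_add f g) x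

theorem IsSelfDual.coe_smul (hG : G.IsSelfDual r) (hr : 0 < r) (hγ : 0 < γ)
    (c : ℂ) (f : G.ell2 r γ) (x : G.Vertex) : (c • f) x = c * f x :=
  (hG.ae_iff hr hγ).1 (Lp.coeFn_smul c f) x

theorem IsSelfDual.coe_zero (hG : G.IsSelfDual r) (hr : 0 < r) (hγ : 0 < γ)
    (x : G.Vertex) : (0 : G.ell2 r γ) x = 0 :=
  (hG.ae_iff hr hγ).1 (Lp.coeFn_zero ℂ 2 (G.poissonPlancherelMeasure r γ)) x

theorem IsSelfDual.coe_sum_smul (hG : G.IsSelfDual r) (hr : 0 < r) (hγ : 0 < γ)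
    {ι : Type*} (s : Finset ι) (c : ι → ℂ) (f : ι → G.ell2 r γ) (x : G.Vertex) :
    (∑ i ∈ s, c i • f i) x = ∑ i ∈ s, c i * f i x := by
  induction s using Finset.induction_on with
  | empty => simpa using hG.coe_zero hr hγ x
  | insert i s hi ih =>
    rw [Finset.sum_insert hi, Finset.sum_insert hi, hG.coe_add hr hγ, hG.coe_smul hr hγ, ih]

theorem IsSelfDual.inner_eq (hG : G.IsSelfDual r) (hr : 0 < r) (hγ : 0 < γ) (f g : G.ell2 r γ) :
    inner ℂ f g = ∑' x, (G.poissonPlancherel r γ x : ℂ) * (starRingEnd ℂ (f x) * g x) := by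
  rw [L2.inner_def, hG.integral_eq hr hγ]
  refine tsum_congr fun x => ?_
  rw [RCLike.inner_apply, mul_comm (g x)]

theorem IsSelfDual.norm_sq_eq (hG : G.IsSelfDual r) (hr : 0 < r) (hγ : 0 < γ) (f : G.ell2 r γ) :
    ‖f‖ ^ 2 = ∑' x, G.poissonPlancherel r γ x * ‖f x‖ ^ 2 := by
  have h := hG.inner_eq hr hγ f f
  rw [inner_self_eq_norm_sq_to_K] at h
  have h2 : ∑' x, (G.poissonPlancherel r γ x : ℂ) * (starRingEnd ℂ (f x) * f x)
      = ((∑' x, G.poissonPlancherel r γ x * ‖f x‖ ^ 2 : ℝ) : ℂ) := by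
    rw [Complex.ofReal_tsum]
    refine tsum_congr fun x => ?_
    rw [RCLike.conj_mul]
    push_cast
    rfl
  rw [h2] at h
  refine Complex.ofReal_injective ?_
  rw [← h]
  push_cast
  rfl

/-- The indicator function of a vertex belongs to `ℓ²`. -/
theorem IsSelfDual.memLp_single (hG : G.IsSelfDual r) (hr : 0 < r) (hγ : 0 < γ) (x : G.Vertex) :
    MemLp (Pi.single x (1 : ℂ)) 2 (G.poissonPlancherelMeasure r γ) := by
  refine hG.memLp_of_summable hr hγ (summable_of_ne_finset_zero (s := {x}) fun y hy => ?_)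
  rw [Finset.mem_singleton] at hy
  simp [Pi.single_eq_of_ne hy]

theorem IsSelfDual.inner_single (hG : G.IsSelfDual r) (hr : 0 < r) (hγ : 0 < γ) (x : G.Vertex)
    (f : G.ell2 r γ) :
    inner ℂ ((hG.memLp_single hr hγ x).toLp : G.ell2 r γ) f
      = (G.poissonPlancherel r γ x : ℂ) * f x := by
  rw [hG.inner_eq hr hγ, tsum_eq_single x]
  · rw [hG.coe_toLp hr hγ]; simp
  · intro y hy
    rw [hG.coe_toLp hr hγ]; simp [Pi.single_eq_of_ne hy]

/-- Evaluation at `x` is a multiple of the scalar product with the indicator of `x`. -/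
theorem IsSelfDual.continuous_eval (hG : G.IsSelfDual r) (hr : 0 < r) (hγ : 0 < γ)
    (x : G.Vertex) : Continuous fun f : G.ell2 r γ => f x := by
  have h : (fun f : G.ell2 r γ => f x) = fun f => (G.poissonPlancherel r γ x : ℂ)⁻¹ *
      inner ℂ ((hG.memLp_single hr hγ x).toLp : G.ell2 r γ) f := by
    funext f
    have : (G.poissonPlancherel r γ x : ℂ) ≠ 0 := by
      exact_mod_cast (hG.poissonPlancherel_pos hr hγ x).ne'
    rw [hG.inner_single hr hγ, inv_mul_cancel_left₀ this]
  rw [h]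
  fun_prop

/-- Dominated convergence for functions which are eventually constant at every vertex. -/
theorem IsSelfDual.tendsto_toLp (hG : G.IsSelfDual r) (hr : 0 < r) (hγ : 0 < γ)
    {F : ℕ → G.Vertex → ℂ} {f : G.Vertex → ℂ} {b : G.Vertex → ℝ}
    (hF : ∀ n, MemLp (F n) 2 (G.poissonPlancherelMeasure r γ))
    (hf : MemLp f 2 (G.poissonPlancherelMeasure r γ))
    (hFb : ∀ n x, ‖F n x‖ ≤ b x) (hfb : ∀ x, ‖f x‖ ≤ b x)
    (hb : Summable fun x => G.poissonPlancherel r γ x * b x ^ 2)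
    (hlim : ∀ x, ∀ᶠ n in atTop, F n x = f x) :
    Tendsto (fun n => ((hF n).toLp : G.ell2 r γ)) atTop (𝓝 hf.toLp) := by
  rw [tendsto_iff_norm_sub_tendsto_zero]
  have h : Tendsto (fun n => ‖((hF n).toLp : G.ell2 r γ) - hf.toLp‖ ^ 2) atTop (𝓝 0) := by
    have h1 : ∀ n, ‖((hF n).toLp : G.ell2 r γ) - hf.toLp‖ ^ 2
        = ∑' x, G.poissonPlancherel r γ x * ‖F n x - f x‖ ^ 2 := by
      intro n
      rw [hG.norm_sq_eq hr hγ]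
      refine tsum_congr fun x => ?_
      rw [hG.coe_sub hr hγ, hG.coe_toLp hr hγ, hG.coe_toLp hr hγ]
    simp only [h1]
    rw [← tsum_zero (α := ℝ) (β := G.Vertex)]
    refine tendsto_tsum_of_dominated_convergence (hb.mul_left 4) (fun x => ?_)
      (Eventually.of_forall fun n x => ?_)
    · refine tendsto_const_nhds.congr' ?_
      filter_upwards [hlim x] with n hn
      simp [hn]
    · have hw := (hG.poissonPlancherel_pos hr hγ x).le
      rw [Real.norm_of_nonneg (by positivity)]
      have h2 : ‖F n x - f x‖ ≤ 2 * b x := by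
        have := norm_sub_le (F n x) (f x)
        have := hFb n x
        have := hfb x
        linarith
      calc _ ≤ G.poissonPlancherel r γ x * (2 * b x) ^ 2 := by gcongr
        _ = _ := by ring
  have h7 := h.sqrt
  simp only [Real.sqrt_zero] at h7
  exact h7.congr fun n => Real.sqrt_sq (norm_nonneg _)

end Hilbert

/-! ### The orthogonal basis -/

section Basis

theorem IsSelfDual.memLp_charlierFun (hG : G.IsSelfDual r) (hr : 0 < r) (hγ : 0 < γ)
    (l : G.Vertex) :
    MemLp (fun x => (G.charlierFun γ l x : ℂ)) 2 (G.poissonPlancherelMeasure r γ) := by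
  refine hG.memLp_of_summable hr hγ ?_
  refine (hG.hasSum_charlierFun hr hγ l l).summable.congr fun x => ?_
  rw [Complex.norm_real, Real.norm_eq_abs, sq_abs, sq]

theorem IsSelfDual.inner_charlierFun (hG : G.IsSelfDual r) (hr : 0 < r) (hγ : 0 < γ)
    (l m : G.Vertex) :
    inner ℂ ((hG.memLp_charlierFun hr hγ l).toLp : G.ell2 r γ)
        ((hG.memLp_charlierFun hr hγ m).toLp : G.ell2 r γ)
      = if l = m then (γ : ℂ) ^ G.level l else 0 := by
  rw [hG.inner_eq hr hγ]
  have h := Complex.hasSum_ofReal.2 (hG.hasSum_charlierFun hr hγ l m)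
  have h2 : (((if l = m then γ ^ G.level l else 0 : ℝ)) : ℂ)
      = if l = m then (γ : ℂ) ^ G.level l else 0 := by
    split_ifs <;> simp
  rw [← h2, ← h.tsum_eq]
  refine tsum_congr fun x => ?_
  rw [hG.coe_toLp hr hγ, hG.coe_toLp hr hγ, Complex.conj_ofReal]
  push_cast
  rfl

theorem IsSelfDual.topologicalClosure_span_charlierFun (hG : G.IsSelfDual r) (hr : 0 < r)
    (hγ : 0 < γ) :
    (Submodule.span ℂ (Set.range fun l : G.Vertex =>
      ((hG.memLp_charlierFun hr hγ l).toLp : G.ell2 r γ))).topologicalClosure = ⊤ := by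
  set C : G.Vertex → G.ell2 r γ := fun l => (hG.memLp_charlierFun hr hγ l).toLp with hC
  set c : G.Vertex → ℝ := fun l => Real.sqrt (γ⁻¹ ^ G.level l) with hc
  have hc2 : ∀ l, c l ^ 2 = γ⁻¹ ^ G.level l := fun l => Real.sq_sqrt (by positivity)
  set v : G.Vertex → G.ell2 r γ := fun l => (c l : ℂ) • C l with hv
  have hon : Orthonormal ℂ v := by
    rw [orthonormal_iff_ite]
    intro l m
    rw [hv, inner_smul_left, inner_smul_right, hC, hG.inner_charlierFun hr hγ, Complex.conj_ofReal]
    split_ifs with h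
    · subst h
      have h3 : c l * (c l * γ ^ G.level l) = 1 := by
        rw [← mul_assoc, ← sq, hc2, ← mul_pow, inv_mul_cancel₀ hγ.ne', one_pow]
      exact_mod_cast h3
    · simp
  have hspan : Submodule.span ℂ (Set.range v) ≤ Submodule.span ℂ (Set.range C) := by
    rw [Submodule.span_le]
    rintro _ ⟨l, rfl⟩
    exact Submodule.smul_mem _ _ (Submodule.subset_span (Set.mem_range_self l))
  -- The dual orthogonality relation is Parseval's identity for an indicator with respect to the
  -- normalized family `v`.
  have hsingle : ∀ x, ((hG.memLp_single hr hγ x).toLp : G.ell2 r γ)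
      ∈ (Submodule.span ℂ (Set.range C)).topologicalClosure := by
    intro x
    refine Submodule.topologicalClosure_mono hspan (hon.mem_closure_span_of_hasSum _ ?_)
    have hn : ‖((hG.memLp_single hr hγ x).toLp : G.ell2 r γ)‖ ^ 2
        = G.poissonPlancherel r γ x := by
      rw [hG.norm_sq_eq hr hγ, tsum_eq_single x]
      · rw [hG.coe_toLp hr hγ]; simp
      · intro y hy
        rw [hG.coe_toLp hr hγ]; simp [Pi.single_eq_of_ne hy]
    rw [hn]
    refine (hG.hasSum_charlierFun_dual hr hγ x).congr_fun fun l => ?_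
    rw [norm_inner_symm, hG.inner_single hr hγ, hv, hG.coe_smul hr hγ, hC, hG.coe_toLp hr hγ,
      ← hc2, norm_mul, norm_mul, Complex.norm_real, Complex.norm_real, Complex.norm_real]
    simp only [Real.norm_eq_abs, mul_pow, sq_abs]
    ring
  rw [Submodule.topologicalClosure_eq_top_iff, Submodule.eq_bot_iff]
  intro g hg
  -- A vector orthogonal to the span is orthogonal to all indicators, hence vanishes at every
  -- vertex.
  refine hG.ell2_ext hr hγ fun x => ?_
  rw [← Submodule.orthogonal_closure] at hg
  have h4 := (Submodule.mem_orthogonal _ _).1 hg _ (hsingle x)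
  rw [hG.inner_single hr hγ, mul_eq_zero, Complex.ofReal_eq_zero] at h4
  rw [hG.coe_zero hr hγ]
  exact h4.resolve_left (hG.poissonPlancherel_pos hr hγ x).ne'

end Basis

/-! ### The generator: closability, domain and eigenfunctions -/

section Generator

theorem jumpRate_eq_zero {x k : G.Vertex} (h1 : k ≠ x) (h2 : k ∉ G.lower x)
    (h3 : k ∉ G.upper x) : G.jumpRate r γ x k = 0 := by
  rw [jumpRate, if_neg h1, if_neg (mt G.mem_lower.2 h2), if_neg (mt G.mem_upper.2 h3)]

theorem jumpRate_eq_zero_of_lt {x k : G.Vertex} (h : G.level x + 1 < G.level k) :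
    G.jumpRate r γ x k = 0 := by
  refine jumpRate_eq_zero (by rintro rfl; omega) (fun h2 => ?_) (fun h2 => ?_)
  · have := G.level_lower h2; omega
  · have := G.level_upper h2; omega

theorem jumpRate_self (x : G.Vertex) :
    G.jumpRate r γ x x = -((G.level x : ℝ) + γ * r) := if_pos rfl

/-- Conjugation by |x|! / dim x removes the dimensions from the rates: the downward jumps become U°,
and in `IsSelfDual.jumpRate_upper` the upward jumps become γ D°. -/
theorem jumpRate_lower {x k : G.Vertex} (h : k ∈ G.lower x) :
    G.jumpRate r γ x k * ((G.level k).factorial / G.dim k)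
      = (G.level x).factorial / G.dim x * G.mult k x := by
  have hl := G.level_lower h
  rw [jumpRate, if_neg (by rintro rfl; omega), if_pos (G.mem_lower.1 h), pDown,
    if_pos (G.mem_lower.1 h), hl, Nat.factorial_succ]
  have := (G.dim_pos x).ne'
  have := (G.dim_pos k).ne'
  push_cast
  field_simp

theorem IsSelfDual.jumpRate_upper (hG : G.IsSelfDual r) (hr : 0 < r) {x k : G.Vertex}
    (h : k ∈ G.upper x) :
    G.jumpRate r γ x k * ((G.level k).factorial / G.dim k)
      = (G.level x).factorial / G.dim x * (γ * G.mult x k) := by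
  have hl := G.level_upper h
  have hnl : ¬ G.Edge k x := fun h2 => by have := G.level_of_edge h2; omega
  rw [jumpRate, if_neg (by rintro rfl; omega), if_neg hnl, if_pos (G.mem_upper.1 h), pUp, pDown,
    if_pos (G.mem_upper.1 h), ← hl, hG.plancherel_level, hG.plancherel_level, hl,
    Nat.factorial_succ]
  have := (G.dim_pos x).ne'
  have := (G.dim_pos k).ne'
  have := Nat.factorial_ne_zero (G.level x)
  push_cast
  field_simp
  ring

theorem sum_ball_eq_sum_neighbors {M : Type*} [AddCommMonoid M] (x : G.Vertex)
    (g : G.Vertex → M) (hg : ∀ k, k ≠ x → k ∉ G.lower x → k ∉ G.upper x → g k = 0) :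
    ∑ k ∈ G.ball (G.level x + 1), g k = g x + ∑ k ∈ G.lower x, g k + ∑ k ∈ G.upper x, g k := by
  have hx : x ∉ G.lower x := fun h => by have := G.level_lower h; omega
  have hd : Disjoint (insert x (G.lower x)) (G.upper x) := by
    rw [Finset.disjoint_left]
    intro k hk hk2
    have := G.level_upper hk2
    rcases Finset.mem_insert.1 hk with rfl | hk
    · omega
    · have := G.level_lower hk; omega
  rw [← Finset.sum_insert hx, ← Finset.sum_union hd]
  symm
  refine Finset.sum_subset (fun k hk => ?_) fun k _ hk => ?_
  · rw [mem_ball]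
    rcases Finset.mem_union.1 hk with hk | hk
    · rcases Finset.mem_insert.1 hk with rfl | hk
      · omega
      · have := G.level_lower hk; omega
    · have := G.level_upper hk; omega
  · simp only [Finset.mem_union, Finset.mem_insert, not_or] at hk
    exact hg k hk.1.1 hk.1.2 hk.2

theorem jumpOp_eq_sum (f : G.Vertex →₀ ℂ) (x : G.Vertex) :
    G.jumpOp r γ f x = ∑ k ∈ G.ball (G.level x + 1), (G.jumpRate r γ x k : ℂ) * f k := by
  rw [jumpOp, Finsupp.sum]
  have h1 : ∑ k ∈ f.support, (G.jumpRate r γ x k : ℂ) * f k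
      = ∑ k ∈ f.support ∪ G.ball (G.level x + 1), (G.jumpRate r γ x k : ℂ) * f k := by
    refine Finset.sum_subset Finset.subset_union_left fun k _ hk => ?_
    rw [Finsupp.notMem_support_iff.1 hk, mul_zero]
  rw [h1]
  symm
  refine Finset.sum_subset Finset.subset_union_right fun k _ hk => ?_
  rw [mem_ball, not_le] at hk
  rw [jumpRate_eq_zero_of_lt hk, Complex.ofReal_zero, zero_mul]

/-- At each vertex the action of A involves finitely many evaluations, all continuous, so the
pointwise formula is a closed condition and survives in the closure of the graph. -/
theorem IsSelfDual.apply_snd_of_mem_closure (hG : G.IsSelfDual r) (hr : 0 < r) (hγ : 0 < γ)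
    {p : G.ell2 r γ × G.ell2 r γ} (hp : p ∈ (G.preGeneratorGraph r γ).topologicalClosure)
    (x : G.Vertex) :
    p.2 x = ∑ k ∈ G.ball (G.level x + 1), (G.jumpRate r γ x k : ℂ) * p.1 k := by
  have hcl : IsClosed {p : G.ell2 r γ × G.ell2 r γ |
      p.2 x = ∑ k ∈ G.ball (G.level x + 1), (G.jumpRate r γ x k : ℂ) * p.1 k} := by
    refine isClosed_eq ((hG.continuous_eval hr hγ x).comp continuous_snd) ?_
    exact continuous_finsetSum _ fun k _ =>
      continuous_const.mul ((hG.continuous_eval hr hγ k).comp continuous_fst)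
  refine closure_minimal ?_ hcl hp
  rintro q ⟨f, hf1, hf2⟩
  have h1 := (hG.ae_iff hr hγ).1 hf1
  have h2 := (hG.ae_iff hr hγ).1 hf2
  rw [Set.mem_ofPred_eq, h2, jumpOp_eq_sum]
  exact Finset.sum_congr rfl fun k _ => by rw [h1]

theorem IsSelfDual.snd_eq_zero_of_mem_closure (hG : G.IsSelfDual r) (hr : 0 < r) (hγ : 0 < γ)
    (p : G.ell2 r γ × G.ell2 r γ) (hp : p ∈ (G.preGeneratorGraph r γ).topologicalClosure)
    (h0 : p.1 = 0) : p.2 = 0 := by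
  refine hG.ell2_ext hr hγ fun x => ?_
  rw [hG.apply_snd_of_mem_closure hr hγ hp, h0, hG.coe_zero hr hγ]
  exact Finset.sum_eq_zero fun k _ => by rw [hG.coe_zero hr hγ, mul_zero]

/-- `toLinearPMap` recovers a submodule as its graph only if the submodule is single-valued, which
the pointwise formula guarantees. -/
theorem IsSelfDual.graph_preGenerator (hG : G.IsSelfDual r) (hr : 0 < r) (hγ : 0 < γ) :
    (G.preGenerator r γ).graph = G.preGeneratorGraph r γ :=
  Submodule.toLinearPMap_graph_eq _ fun p hp h0 =>
    hG.snd_eq_zero_of_mem_closure hr hγ p (Submodule.le_topologicalClosure _ hp) h0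

theorem IsSelfDual.isClosable_preGenerator (hG : G.IsSelfDual r) (hr : 0 < r) (hγ : 0 < γ) :
    (G.preGenerator r γ).IsClosable := by
  refine ⟨(G.preGeneratorGraph r γ).topologicalClosure.toLinearPMap, ?_⟩
  rw [hG.graph_preGenerator hr hγ]
  exact (Submodule.toLinearPMap_graph_eq _ (hG.snd_eq_zero_of_mem_closure hr hγ)).symm

/-- A function belongs to the domain of the closure as soon as the sums defining its image converge
absolutely to a square integrable function. -/
theorem IsSelfDual.mem_closure_preGeneratorGraph (hG : G.IsSelfDual r) (hr : 0 < r) (hγ : 0 < γ)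
    {f g : G.Vertex → ℂ} (hf : MemLp f 2 (G.poissonPlancherelMeasure r γ))
    (hg : MemLp g 2 (G.poissonPlancherelMeasure r γ))
    (hfg : ∀ x, g x = ∑ k ∈ G.ball (G.level x + 1), (G.jumpRate r γ x k : ℂ) * f k)
    (hf2 : Summable fun x => G.poissonPlancherel r γ x * ‖f x‖ ^ 2)
    (hb : Summable fun x => G.poissonPlancherel r γ x *
      (∑ k ∈ G.ball (G.level x + 1), |G.jumpRate r γ x k| * ‖f k‖) ^ 2) :
    ((hf.toLp, hg.toLp) : G.ell2 r γ × G.ell2 r γ)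
      ∈ (G.preGeneratorGraph r γ).topologicalClosure := by
  -- The approximants are the truncations of `f` to balls; at each vertex they and their images are
  -- eventually exact.
  set F : ℕ → G.Vertex →₀ ℂ := fun N => Finsupp.onFinset (G.ball N)
    (fun k => if k ∈ G.ball N then f k else 0) (fun k hk => by
      by_contra h; exact hk (if_neg h)) with hF
  have hFf : ∀ N k, ‖F N k‖ ≤ ‖f k‖ := by
    intro N k
    rw [hF, Finsupp.onFinset_apply]
    split_ifs
    · exact le_rfl
    · rw [norm_zero]; exact norm_nonneg _
  have hAF : ∀ N x, ‖G.jumpOp r γ (F N) x‖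
      ≤ ∑ k ∈ G.ball (G.level x + 1), |G.jumpRate r γ x k| * ‖f k‖ := by
    intro N x
    rw [jumpOp_eq_sum]
    refine (norm_sum_le _ _).trans (Finset.sum_le_sum fun k _ => ?_)
    rw [norm_mul, Complex.norm_real, Real.norm_eq_abs]
    exact mul_le_mul_of_nonneg_left (hFf N k) (abs_nonneg _)
  have hgb : ∀ x, ‖g x‖ ≤ ∑ k ∈ G.ball (G.level x + 1), |G.jumpRate r γ x k| * ‖f k‖ := by
    intro x
    rw [hfg]
    refine (norm_sum_le _ _).trans (Finset.sum_le_sum fun k _ => ?_)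
    rw [norm_mul, Complex.norm_real, Real.norm_eq_abs]
  have hFeq : ∀ N k, G.level k ≤ N → F N k = f k := fun N k h => by
    rw [hF, Finsupp.onFinset_apply, if_pos (G.mem_ball.2 h)]
  have h1 : ∀ N, MemLp (F N) 2 (G.poissonPlancherelMeasure r γ) :=
    fun N => hG.memLp_of_le hr hγ (hFf N) hf2
  have h2 : ∀ N, MemLp (G.jumpOp r γ (F N)) 2 (G.poissonPlancherelMeasure r γ) :=
    fun N => hG.memLp_of_le hr hγ (hAF N) hb
  have t1 := hG.tendsto_toLp hr hγ h1 hf hFf (fun _ => le_rfl) hf2 fun x =>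
    (eventually_ge_atTop (G.level x)).mono fun N hN => hFeq N x hN
  have t2 := hG.tendsto_toLp hr hγ h2 hg hAF hgb hb fun x =>
    -- One more level is needed, since A at `x` reads the values at the upper neighbours of `x`.
    (eventually_ge_atTop (G.level x + 1)).mono fun N hN => by
      rw [jumpOp_eq_sum, hfg]
      refine Finset.sum_congr rfl fun k hk => ?_
      rw [hFeq N k ((G.mem_ball.1 hk).trans hN)]
  exact mem_closure_of_tendsto (t1.prodMk_nhds t2) (Eventually.of_forall fun N =>
    ⟨F N, (h1 N).coeFn_toLp, (h2 N).coeFn_toLp⟩)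

/-- After conjugation, U° contributes |x| - |m| and γ D° contributes γ r plus the sum over lower
neighbours of `m`; the diagonal rate cancels |x| and γ r. -/
theorem IsSelfDual.sum_jumpRate_mul_relDimFun (hG : G.IsSelfDual r) (hr : 0 < r)
    (m x : G.Vertex) :
    ∑ k ∈ G.ball (G.level x + 1), G.jumpRate r γ x k * G.relDimFun m k
      = -(G.level m : ℝ) * G.relDimFun m x
        + γ * G.lowerSum (fun k => G.relDimFun k x) m := by
  rw [sum_ball_eq_sum_neighbors x _ fun k h1 h2 h3 => by rw [jumpRate_eq_zero h1 h2 h3, zero_mul]]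
  set c : ℝ := (G.level x).factorial / G.dim x with hc
  have h1 : ∑ k ∈ G.lower x, G.jumpRate r γ x k * G.relDimFun m k
      = c * G.lowerSum (G.expKernel m) x := by
    rw [lowerSum, Finset.mul_sum]
    refine Finset.sum_congr rfl fun k hk => ?_
    rw [relDimFun_eq, ← mul_assoc, jumpRate_lower hk, mul_assoc]
  have h2 : ∑ k ∈ G.upper x, G.jumpRate r γ x k * G.relDimFun m k
      = c * (γ * G.upperSum (G.expKernel m) x) := by
    rw [upperSum, Finset.mul_sum, Finset.mul_sum]
    refine Finset.sum_congr rfl fun k hk => ?_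
    rw [relDimFun_eq, ← mul_assoc, hG.jumpRate_upper hr hk]
    ring
  have h3 : G.lowerSum (fun k => G.relDimFun k x) m
      = c * G.lowerSum (fun k => G.expKernel k x) m := by
    simp only [relDimFun_eq]
    rw [lowerSum_const_mul]
  rw [h1, h2, h3, jumpRate_self, relDimFun_eq, lowerSum_expKernel, hG.upperSum_expKernel]
  ring

theorem relDimFun_nonneg (m x : G.Vertex) : 0 ≤ G.relDimFun m x := by
  rw [relDimFun_eq]
  exact mul_nonneg (div_nonneg (Nat.cast_nonneg _) (G.dim_pos x).le) (G.expKernel_nonneg m x)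

theorem mult_lower_nonneg {k m : G.Vertex} (h : k ∈ G.lower m) : 0 ≤ G.mult k m :=
  (G.mult_pos (G.mem_lower.1 h)).le

theorem IsSelfDual.jumpRate_nonneg (hG : G.IsSelfDual r) (hr : 0 < r) (hγ : 0 < γ)
    {x k : G.Vertex} (h : k ≠ x) : 0 ≤ G.jumpRate r γ x k := by
  have hpos : 0 < ((G.level k).factorial : ℝ) / G.dim k := by
    have := G.dim_pos k
    positivity
  have hpos' : 0 < ((G.level x).factorial : ℝ) / G.dim x := by
    have := G.dim_pos x
    positivity
  refine nonneg_of_mul_nonneg_left (b := ((G.level k).factorial : ℝ) / G.dim k) ?_ hpos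
  by_cases h1 : k ∈ G.lower x
  · rw [jumpRate_lower h1]
    exact mul_nonneg hpos'.le (mult_lower_nonneg h1)
  by_cases h2 : k ∈ G.upper x
  · rw [hG.jumpRate_upper hr h2]
    exact mul_nonneg hpos'.le (mul_nonneg hγ.le (G.mult_pos (G.mem_upper.1 h2)).le)
  · rw [jumpRate_eq_zero h h1 h2, zero_mul]

/-- Only the diagonal rate is negative, so passing to absolute values adds 2 (|x| + γ r) P*_m(x) to
the signed sum. -/
theorem IsSelfDual.sum_abs_jumpRate_mul_relDimFun (hG : G.IsSelfDual r) (hr : 0 < r) (hγ : 0 < γ)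
    (m x : G.Vertex) :
    ∑ k ∈ G.ball (G.level x + 1), |G.jumpRate r γ x k| * G.relDimFun m k
      = (2 * (G.level x + γ * r) - G.level m) * G.relDimFun m x
        + γ * G.lowerSum (fun k => G.relDimFun k x) m := by
  have h1 := hG.sum_jumpRate_mul_relDimFun (γ := γ) hr m x
  have hx : x ∈ G.ball (G.level x + 1) := G.mem_ball.2 (by omega)
  rw [← Finset.add_sum_erase _ _ hx] at h1 ⊢
  have h2 : ∑ k ∈ (G.ball (G.level x + 1)).erase x, |G.jumpRate r γ x k| * G.relDimFun m k
      = ∑ k ∈ (G.ball (G.level x + 1)).erase x, G.jumpRate r γ x k * G.relDimFun m k := by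
    refine Finset.sum_congr rfl fun k hk => ?_
    rw [abs_of_nonneg (hG.jumpRate_nonneg hr hγ (Finset.ne_of_mem_erase hk))]
  have h3 : (0 : ℝ) ≤ G.level x + γ * r := by positivity
  rw [h2, jumpRate_self, abs_neg, abs_of_nonneg h3]
  rw [jumpRate_self] at h1
  linarith

theorem IsSelfDual.summable_sq_add (hG : G.IsSelfDual r) (hr : 0 < r) (hγ : 0 < γ)
    {f g : G.Vertex → ℝ} (hf : Summable fun x => G.poissonPlancherel r γ x * f x ^ 2)
    (hg : Summable fun x => G.poissonPlancherel r γ x * g x ^ 2) :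
    Summable fun x => G.poissonPlancherel r γ x * (f x + g x) ^ 2 := by
  refine Summable.of_nonneg_of_le (fun x => ?_) (fun x => ?_) ((hf.add hg).mul_left 2)
  · have := (hG.poissonPlancherel_pos hr hγ x).le
    positivity
  · have := (hG.poissonPlancherel_pos hr hγ x).le
    have h := mul_nonneg this (sq_nonneg (f x - g x))
    nlinarith

theorem summable_sq_const_mul (c : ℝ) {f : G.Vertex → ℝ}
    (hf : Summable fun x => G.poissonPlancherel r γ x * f x ^ 2) :
    Summable fun x => G.poissonPlancherel r γ x * (c * f x) ^ 2 :=
  (hf.mul_left (c ^ 2)).congr fun x => by ring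

theorem IsSelfDual.summable_sq_sum (hG : G.IsSelfDual r) (hr : 0 < r) (hγ : 0 < γ)
    {ι : Type*} (s : Finset ι) (f : ι → G.Vertex → ℝ)
    (hf : ∀ i ∈ s, Summable fun x => G.poissonPlancherel r γ x * f i x ^ 2) :
    Summable fun x => G.poissonPlancherel r γ x * (∑ i ∈ s, f i x) ^ 2 := by
  induction s using Finset.induction_on with
  | empty => simp
  | insert i s hi ih =>
    simp only [Finset.sum_insert hi]
    exact hG.summable_sq_add hr hγ (hf i (Finset.mem_insert_self i s))
      (ih fun j hj => hf j (Finset.mem_insert_of_mem hj))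

theorem IsSelfDual.summable_sq_of_le (hG : G.IsSelfDual r) (hr : 0 < r) (hγ : 0 < γ)
    {f g : G.Vertex → ℝ} (h0 : ∀ x, 0 ≤ f x) (hfg : ∀ x, f x ≤ g x)
    (hg : Summable fun x => G.poissonPlancherel r γ x * g x ^ 2) :
    Summable fun x => G.poissonPlancherel r γ x * f x ^ 2 := by
  refine Summable.of_nonneg_of_le (fun x => ?_) (fun x => ?_) hg
  · have := (hG.poissonPlancherel_pos hr hγ x).le
    positivity
  · have := (hG.poissonPlancherel_pos hr hγ x).le
    have := h0 x
    have := hfg x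
    gcongr

theorem IsSelfDual.summable_relDimFun (hG : G.IsSelfDual r) (hr : 0 < r) (hγ : 0 < γ)
    (m : G.Vertex) : Summable fun x => G.poissonPlancherel r γ x * G.relDimFun m x ^ 2 := by
  refine hG.summable_sq_of_le hr hγ (relDimFun_nonneg m) (fun x => ?_)
    (hG.summable_level_mul_relDimFun hr hγ m)
  have := mul_nonneg (Nat.cast_nonneg (α := ℝ) (G.level x)) (relDimFun_nonneg m x)
  linarith

theorem IsSelfDual.summable_lowerSum_relDimFun (hG : G.IsSelfDual r) (hr : 0 < r) (hγ : 0 < γ)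
    (m : G.Vertex) : Summable fun x => G.poissonPlancherel r γ x *
      (γ * G.lowerSum (fun k => G.relDimFun k x) m) ^ 2 :=
  summable_sq_const_mul γ (hG.summable_sq_sum hr hγ _ _ fun k _ =>
    summable_sq_const_mul _ (hG.summable_relDimFun hr hγ k))

theorem IsSelfDual.summable_jump_relDimFun (hG : G.IsSelfDual r) (hr : 0 < r) (hγ : 0 < γ)
    (m : G.Vertex) : Summable fun x => G.poissonPlancherel r γ x *
      (∑ k ∈ G.ball (G.level x + 1), |G.jumpRate r γ x k| * G.relDimFun m k) ^ 2 := by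
  -- The constant comes from 2 (|x| + γ r) - |m| ≤ 2 (1 + γ r) (|x| + 1).
  refine hG.summable_sq_of_le hr hγ (fun x => Finset.sum_nonneg fun k _ =>
    mul_nonneg (abs_nonneg _) (relDimFun_nonneg m k)) (fun x => ?_)
    (hG.summable_sq_add hr hγ (summable_sq_const_mul (2 * (1 + γ * r))
      (hG.summable_level_mul_relDimFun hr hγ m)) (hG.summable_lowerSum_relDimFun hr hγ m))
  rw [hG.sum_abs_jumpRate_mul_relDimFun hr hγ, add_le_add_iff_right, ← mul_assoc]
  refine mul_le_mul_of_nonneg_right ?_ (relDimFun_nonneg m x)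
  have h1 : (0 : ℝ) ≤ G.level m := Nat.cast_nonneg _
  have h2 : (0 : ℝ) ≤ G.level x := Nat.cast_nonneg _
  have h3 : 0 ≤ γ * r := by positivity
  nlinarith [mul_nonneg h3 h2]

/-- The action of the closure of the generator on the functions `P*_m`. -/
theorem IsSelfDual.exists_mem_closure_relDimFun (hG : G.IsSelfDual r) (hr : 0 < r) (hγ : 0 < γ)
    (m : G.Vertex) :
    ∃ p ∈ (G.preGeneratorGraph r γ).topologicalClosure,
      (∀ x, p.1 x = (G.relDimFun m x : ℂ)) ∧
      ∀ x, p.2 x = ((-(G.level m : ℝ) * G.relDimFun m x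
        + γ * G.lowerSum (fun k => G.relDimFun k x) m : ℝ) : ℂ) := by
  have hn : ∀ x, ‖(G.relDimFun m x : ℂ)‖ = G.relDimFun m x := fun x => by
    rw [Complex.norm_real, Real.norm_of_nonneg (relDimFun_nonneg m x)]
  have hf2 : Summable fun x => G.poissonPlancherel r γ x * ‖(G.relDimFun m x : ℂ)‖ ^ 2 := by
    simpa only [hn] using hG.summable_relDimFun hr hγ m
  have hf := hG.memLp_of_summable hr hγ hf2
  have hg : MemLp (fun x => ((-(G.level m : ℝ) * G.relDimFun m x
      + γ * G.lowerSum (fun k => G.relDimFun k x) m : ℝ) : ℂ)) 2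
      (G.poissonPlancherelMeasure r γ) := by
    refine hG.memLp_of_summable hr hγ ?_
    refine (hG.summable_sq_add hr hγ (summable_sq_const_mul (-(G.level m : ℝ))
      (hG.summable_relDimFun hr hγ m)) (hG.summable_lowerSum_relDimFun hr hγ m)).congr fun x => ?_
    rw [Complex.norm_real, Real.norm_eq_abs, sq_abs]
  refine ⟨_, hG.mem_closure_preGeneratorGraph hr hγ hf hg (fun x => ?_) hf2 ?_,
    hG.coe_toLp hr hγ hf, hG.coe_toLp hr hγ hg⟩
  · rw [← hG.sum_jumpRate_mul_relDimFun hr]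
    push_cast
    rfl
  · simpa only [hn] using hG.summable_jump_relDimFun hr hγ m

/-- Summation by parts moves the lower neighbours onto the coefficients of C_l, where they give
-(|l| - |m|); together with -|m| this is -|l|, independently of `m`. -/
theorem sum_eigenvalue (l : G.Vertex) (x : G.Vertex) :
    ∑ m ∈ G.ball (G.level l), (-γ) ^ (G.level l - G.level m) * G.expKernel m l *
        (-(G.level m : ℝ) * G.relDimFun m x + γ * G.lowerSum (fun k => G.relDimFun k x) m)
      = -(G.level l : ℝ) * G.charlierFun γ l x := by
  have key := G.sum_ball_mul_lowerSum (G.level l)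
    (fun m => (-γ) ^ (G.level l - G.level m) * G.expKernel m l) (fun k => G.relDimFun k x)
    (fun m hm => by rw [G.expKernel_eq_zero_of_lt hm, mul_zero])
  have h1 : ∀ m ∈ G.ball (G.level l),
      γ * G.upperSum (fun m => (-γ) ^ (G.level l - G.level m) * G.expKernel m l) m
        = -(((G.level l : ℝ) - G.level m) *
          ((-γ) ^ (G.level l - G.level m) * G.expKernel m l)) := by
    intro m _
    rw [mul_left_comm, ← upperSum_expKernel_left, upperSum, upperSum, Finset.mul_sum,
      Finset.mul_sum, ← Finset.sum_neg_distrib]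
    refine Finset.sum_congr rfl fun k hk => ?_
    have hk := G.level_upper hk
    rcases lt_or_ge (G.level l) (G.level k) with h | h
    · rw [G.expKernel_eq_zero_of_lt h]; ring
    · rw [show G.level l - G.level m = (G.level l - G.level k) + 1 by omega, pow_succ]
      ring
  rw [charlierFun_eq_sum, Finset.mul_sum]
  have h2 : ∀ m, (-γ) ^ (G.level l - G.level m) * G.expKernel m l *
        (-(G.level m : ℝ) * G.relDimFun m x + γ * G.lowerSum (fun k => G.relDimFun k x) m)
      = -(G.level m : ℝ) * ((-γ) ^ (G.level l - G.level m) * G.expKernel m l * G.relDimFun m x)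
        + γ * ((-γ) ^ (G.level l - G.level m) * G.expKernel m l *
          G.lowerSum (fun k => G.relDimFun k x) m) := fun m => by ring
  simp only [h2]
  rw [Finset.sum_add_distrib, ← Finset.mul_sum (a := γ), key, Finset.mul_sum,
    ← Finset.sum_add_distrib]
  refine Finset.sum_congr rfl fun m hm => ?_
  rw [← mul_assoc γ, h1 m hm]
  ring

theorem IsSelfDual.charlierFun_mem_closure (hG : G.IsSelfDual r) (hr : 0 < r) (hγ : 0 < γ)
    (l : G.Vertex) :
    (((hG.memLp_charlierFun hr hγ l).toLp : G.ell2 r γ),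
      -(G.level l : ℂ) • ((hG.memLp_charlierFun hr hγ l).toLp : G.ell2 r γ))
      ∈ (G.preGeneratorGraph r γ).topologicalClosure := by
  choose p hp h1 h2 using hG.exists_mem_closure_relDimFun (γ := γ) hr hγ
  have hmem : ∑ m ∈ G.ball (G.level l),
      (((-γ) ^ (G.level l - G.level m) * G.expKernel m l : ℝ) : ℂ) • p m
        ∈ (G.preGeneratorGraph r γ).topologicalClosure :=
    Submodule.sum_mem _ fun m _ => Submodule.smul_mem _ _ (hp m)
  convert hmem using 1
  refine Prod.ext (hG.ell2_ext hr hγ fun x => ?_) (hG.ell2_ext hr hγ fun x => ?_)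
  · rw [Prod.fst_sum]
    simp only [Prod.smul_fst]
    rw [hG.coe_sum_smul hr hγ, hG.coe_toLp hr hγ, charlierFun_eq_sum]
    simp only [h1]
    push_cast
    rfl
  · rw [Prod.snd_sum]
    simp only [Prod.smul_snd]
    rw [hG.coe_sum_smul hr hγ, hG.coe_smul hr hγ, hG.coe_toLp hr hγ]
    have h3 := congrArg (fun t : ℝ => (t : ℂ)) (sum_eigenvalue (γ := γ) l x)
    simp only [h2]
    push_cast at h3 ⊢
    exact h3.symm

end Generator

end BranchingGraph

end

theorem mainTheorem12 (G : BranchingGraph.{u}) (r γ : ℝ) (hr : 0 < r) (hγ : 0 < γ)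
    (hG : G.IsSelfDual r) :
    ∃ hC : ∀ l : G.Vertex,
        MemLp (fun x => (G.charlierFun γ l x : ℂ)) 2 (G.poissonPlancherelMeasure r γ),
      -- orthogonality, with the squared norms
      (∀ l m : G.Vertex,
        inner ℂ ((hC l).toLp : G.ell2 r γ) ((hC m).toLp : G.ell2 r γ) =
          if l = m then (γ : ℂ) ^ G.level l else 0) ∧
      -- completeness
      (Submodule.span ℂ (Set.range fun l : G.Vertex =>
        ((hC l).toLp : G.ell2 r γ))).topologicalClosure = ⊤ ∧
      -- the generator is the closure of `A`, and the functions are its eigenfunctions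
      (G.preGenerator r γ).IsClosable ∧
      ∀ l : G.Vertex,
        ∃ hl : ((hC l).toLp : G.ell2 r γ) ∈ (G.preGenerator r γ).closure.domain,
          (G.preGenerator r γ).closure ⟨(hC l).toLp, hl⟩ =
            -(G.level l : ℂ) • ((hC l).toLp : G.ell2 r γ) := by
  refine ⟨hG.memLp_charlierFun hr hγ, hG.inner_charlierFun hr hγ,
    hG.topologicalClosure_span_charlierFun hr hγ, hG.isClosable_preGenerator hr hγ, fun l => ?_⟩
  have h := hG.charlierFun_mem_closure hr hγ l
  -- For a closable operator the closure of the graph is the graph of the closure, so the pair found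
  -- there gives both the domain membership and the eigenvalue equation.
  rw [← hG.graph_preGenerator hr hγ,
    (hG.isClosable_preGenerator hr hγ).graph_closure_eq_closure_graph,
    LinearPMap.mem_graph_iff] at h
  obtain ⟨⟨y, hy⟩, h1, h2⟩ := h
  obtain rfl : y = _ := h1
  exact ⟨hy, h2⟩
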